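/- For a bounded domain $D\subset\mathbb C^n$ and a positive continuous weight $\mu$ on $\overline D$, let $\mathcal O_\mu(D)$ be the Hilbert space of holomorphic functions on $D$ that are square integrable with respect to $\mu\,dV$ ($dV$ is Lebesgue measure), let $K_{D,\mu}(z,w)$ be its reproducing kernel, i.e. $K_{D,\mu}(\cdot,w)\in\mathcal O_\mu(D)$ and $g(w)=\int_D g(\zeta)\,\overline{K_{D,\mu}(\zeta,w)}\,\mu(\zeta)\,dV(\zeta)$ for all $g\in\mathcal O_\mu(D)$ and $w\in D$, and let $$ds^2_{D,\mu}=\sum_{i,j}\frac{\partial^2\log K_{D,\mu}(z,z)}{\partial z_i\,\partial\overline z_j}\,dz_i\otimes d\overline z_j$$ be the weighted Bergman metric. **Theorem 1.3.** Let $D_1\subset\mathbb C^n$ and $D_2\subset\mathbb C^m$ be bounded domains, let $\mu_1,\mu_2$ be positive continuous weights on $\overline{D_1},\overline{D_2}$ respectively, and let $f:(D_1,ds^2_{D_1,\mu_1})\to(D_2,ds^2_{D_2,\mu_2})$ be a holomorphic isometry, that is, a holomorphic map $f:D_1\to D_2$ such that for all $z\in D_1$ and $X\in\mathbb C^n$ the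 length of $df(z)X$ at $f(z)$ with respect to $ds^2_{D_2,\mu_2}$ equals the length of $X$ at $z$ with respect to $ds^2_{D_1,\mu_1}$. Then there exist functions $s_0\in\mathcal O_{\mu_1}(D_1)$ and $r_0\in\mathcal O_{\mu_2}(D_2)$, with neither $s_0$ nor $r_0\circ f$ identically zero on $D_1$, such that $$s_0(z)\,\overline{s_0(w)}\,K_{D_2,\mu_2}(f(z),f(w))=r_0(f(z))\,\overline{r_0(f(w))}\,K_{D_1,\mu_1}(z,w)\qquad\text{for all }z,w\in D_1.$$ In particular, if $D_1=D_2=\mathbb D$ is the unit disc in $\mathbb C$ and $\mu_1\equiv1$, then $f$ is an automorphism of $\mathbb D$ (a holomorphic bijection of $\mathbb D$ onto itself with holomorphic inverse). -/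

import Mathlib

open MeasureTheory ComplexConjugate

noncomputable section

namespace WeightedBergman

/-- A bounded domain: a nonempty, connected, open, bounded subset of `ℂⁿ`. -/
structure IsBoundedDomain {n : ℕ} (D : Set (Fin n → ℂ)) : Prop where
  isOpen : IsOpen D
  isConnected : IsConnected D
  isBounded : Bornology.IsBounded D

/-- A positive continuous weight on the closure of `D`. The values of `μ` off `closure D` play no
role. -/
structure IsPositiveContinuousWeight {n : ℕ} (D : Set (Fin n → ℂ)) (μ : (Fin n → ℂ) → ℝ) :
    Prop where
  continuousOn : ContinuousOn μ (closure D)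
  pos : ∀ z ∈ closure D, 0 < μ z

/-- The measure `μ dV` on `D`, where `dV` is Lebesgue measure on `ℂⁿ`. -/
def weightedVolume {n : ℕ} (D : Set (Fin n → ℂ)) (μ : (Fin n → ℂ) → ℝ) :
    Measure (Fin n → ℂ) :=
  (volume.restrict D).withDensity fun z => ENNReal.ofReal (μ z)

/-- The weighted Bergman space `𝒪_μ(D)`: holomorphic functions on `D` that are square integrable
with respect to `μ dV`. Its elements are represented by functions on `ℂⁿ` of which only the values
on `D` matter. -/
def bergmanSpace {n : ℕ} (D : Set (Fin n → ℂ)) (μ : (Fin n → ℂ) → ℝ) :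
    Set ((Fin n → ℂ) → ℂ) :=
  {g | DifferentiableOn ℂ g D ∧ MemLp g 2 (weightedVolume D μ)}

/-- `k` represents evaluation at `w` on `𝒪_μ(D)`: it belongs to `𝒪_μ(D)` and
`g(w) = ∫_D g(ζ) conj(k(ζ)) μ(ζ) dV(ζ)` for all `g ∈ 𝒪_μ(D)`. -/
def IsEvaluationRepresenter {n : ℕ} (D : Set (Fin n → ℂ)) (μ : (Fin n → ℂ) → ℝ)
    (w : Fin n → ℂ) (k : (Fin n → ℂ) → ℂ) : Prop :=
  k ∈ bergmanSpace D μ ∧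
    ∀ g ∈ bergmanSpace D μ, g w = ∫ ζ, g ζ * conj (k ζ) ∂(weightedVolume D μ)

open Classical in
/-- The weighted Bergman kernel `K_{D,μ}(z, w)`, the reproducing kernel of `𝒪_μ(D)`: for `w ∈ D`,
`K_{D,μ}(·, w)` is the function in `𝒪_μ(D)` that represents evaluation at `w`. For a positive
continuous weight on the closure of a bounded domain it exists (point evaluations are bounded on the
Hilbert space `𝒪_μ(D)`) and its values on `D` are unique; the default value `0` is then never used
for `w ∈ D`. -/
def kernel {n : ℕ} (D : Set (Fin n → ℂ)) (μ : (Fin n → ℂ) → ℝ) (z w : Fin n → ℂ) : ℂ :=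
  if h : ∃ k, IsEvaluationRepresenter D μ w k then h.choose z else 0

/-- The Wirtinger derivative `∂u/∂z_i = (∂u/∂x_i - i ∂u/∂y_i) / 2`. -/
def dz {n : ℕ} (i : Fin n) (u : (Fin n → ℂ) → ℂ) (z : Fin n → ℂ) : ℂ :=
  (fderiv ℝ u z (Pi.single i 1) - Complex.I * fderiv ℝ u z (Pi.single i Complex.I)) / 2

/-- The Wirtinger derivative `∂u/∂z̄_j = (∂u/∂x_j + i ∂u/∂y_j) / 2`. -/
def dzbar {n : ℕ} (j : Fin n) (u : (Fin n → ℂ) → ℂ) (z : Fin n → ℂ) : ℂ :=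
  (fderiv ℝ u z (Pi.single j 1) + Complex.I * fderiv ℝ u z (Pi.single j Complex.I)) / 2

/-- The function `z ↦ log K_{D,μ}(z, z)` (`K_{D,μ}(z, z)` is real and positive on `D`). -/
def logKernel {n : ℕ} (D : Set (Fin n → ℂ)) (μ : (Fin n → ℂ) → ℝ) (z : Fin n → ℂ) : ℂ :=
  (Real.log (kernel D μ z z).re : ℂ)

/-- The squared length of the tangent vector `X` at `z` in the weighted Bergman metric
`ds²_{D,μ} = ∑_{i,j} ∂² log K_{D,μ} / ∂z_i ∂z̄_j dz_i ⊗ dz̄_j`. -/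
def metricNormSq {n : ℕ} (D : Set (Fin n → ℂ)) (μ : (Fin n → ℂ) → ℝ) (z X : Fin n → ℂ) : ℂ :=
  ∑ i, ∑ j, dz i (dzbar j (logKernel D μ)) z * X i * conj (X j)

/-- `f` is a holomorphic isometry `(D₁, ds²_{D₁,μ₁}) → (D₂, ds²_{D₂,μ₂})`: a holomorphic map whose
differential preserves the length of tangent vectors at every point of `D₁`. -/
structure IsHolomorphicIsometry {n m : ℕ}
    (D₁ : Set (Fin n → ℂ)) (μ₁ : (Fin n → ℂ) → ℝ)
    (D₂ : Set (Fin m → ℂ)) (μ₂ : (Fin m → ℂ) → ℝ)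
    (f : (Fin n → ℂ) → (Fin m → ℂ)) : Prop where
  mapsTo : Set.MapsTo f D₁ D₂
  holomorphic : DifferentiableOn ℂ f D₁
  isometry : ∀ z ∈ D₁, ∀ X : Fin n → ℂ,
    metricNormSq D₂ μ₂ (f z) (fderiv ℂ f z X) = metricNormSq D₁ μ₁ z X

/-- The unit disc, as a subset of `ℂ¹`. -/
def disc : Set (Fin 1 → ℂ) := {z | ‖z 0‖ < 1}

/-- `f` restricts to a holomorphic automorphism of `D`: a holomorphic self-map of `D` with a
holomorphic inverse. -/
def IsAutomorphism {n : ℕ} (D : Set (Fin n → ℂ)) (f : (Fin n → ℂ) → (Fin n → ℂ)) : Prop :=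
  Set.MapsTo f D D ∧ DifferentiableOn ℂ f D ∧
    ∃ g : (Fin n → ℂ) → (Fin n → ℂ),
      Set.MapsTo g D D ∧ DifferentiableOn ℂ g D ∧ Set.InvOn g f D D

end WeightedBergman

end

noncomputable section

namespace WeightedBergman

open Metric Set Filter Topology

/-! ### Holomorphic maps between complex normed spaces -/

section Holomorphic

variable {E F : Type*} [NormedAddCommGroup E] [NormedSpace ℂ E]
  [NormedAddCommGroup F] [NormedSpace ℂ F]

/-! The weighted Bergman kernel is a Gram kernel: `exists_gram_map` gives a holomorphic nowhere zero
map `Φ` from the domain to a Hilbert space with `K(z, w) = ⟪Φ w, Φ z⟫`. Hence `log K(z, z) = log ‖Φ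
z‖ ^ 2`, and the Bergman metric is the Gram determinant of `Φ` and its derivatives divided by `‖Φ‖ ^
4` (`metricNormSq_eq_gramForm`). An isometry `f` therefore says that `Φ₂ ∘ f` and `Φ₁` have the same
Levi form of `log ‖·‖ ^ 2`.

Calabi's rigidity applies (`inner_mul_eq_of_gramForm_eq`). Both sides are holomorphic in `z` and
antiholomorphic in `w` once polarized, so equality on the diagonal extends off it. Integrating once
in `z` and once in `w`, near a base point `p`, shows that the two kernels agree after normalization
at `p`; the identity theorem, in each variable separately, spreads this over the domain. The result
is `IsHolomorphicIsometry.kernel_identity`, and up to a constant the two factors in the theorem are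
`K₁(·, p)` and `K₂(·, f p)`.

On the disc with unit weight, `K₁(z, w) = 1 / (π (1 - z w̄) ^ 2)`. If `f z = f z'`, the identity
makes `K₁(z, ·)` and `K₁(z', ·)` proportional, which forces `z = z'`. The image is open, being that
of an injective holomorphic function. It is also closed in the disc: as `x` tends to the boundary
`K₁(x, x)` blows up while `K₁(x, p)` stays bounded, so a limit value `q` of `f` inside the disc
would make `K₂(q, ·)` vanish on the open image, hence everywhere, contradicting `K₂(q, q) > 0`. -/

theorem norm_fderiv_le_of_ball {f : E → F} {c : E} {R C : ℝ} (hR : 0 < R)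
    (hd : DifferentiableOn ℂ f (ball c R)) (hC : ∀ z ∈ ball c R, ‖f z‖ ≤ C) :
    ‖fderiv ℂ f c‖ ≤ 2 * C / R := by
  refine Complex.norm_fderiv_le_div_of_mapsTo_ball hd (fun z hz => ?_) hR
  rw [mem_closedBall, dist_eq_norm]
  have h1 := hC z hz
  have h2 := hC c (mem_ball_self hR)
  linarith [norm_sub_le (f z) (f c)]

/-- A second order Schwarz lemma applied to `f` minus its linear part. The bound involves only the
supremum of `f` on the ball, so it is uniform over families; this is what makes difference quotients
converge uniformly and turns weak differentiability into strong. -/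
theorem norm_sub_sub_fderiv_le {f : E → F} {c z : E} {R C : ℝ}
    (hd : DifferentiableOn ℂ f (ball c R)) (hC : ∀ z ∈ ball c R, ‖f z‖ ≤ C)
    (hz : z ∈ ball c R) :
    ‖f z - f c - fderiv ℂ f c (z - c)‖ ≤ 4 * C * (‖z - c‖ / R) ^ 2 := by
  have hR : 0 < R := nonempty_ball.mp ⟨_, hz⟩
  set L := fderiv ℂ f c
  have hL : ‖L‖ ≤ 2 * C / R := norm_fderiv_le_of_ball hR hd hC
  set g : E → F := fun w => f w - L (w - c)
  have hg : DifferentiableOn ℂ g (ball c R) :=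
    hd.sub (L.differentiable.comp (differentiable_id.sub_const c)).differentiableOn
  have hfc : HasFDerivAt f L c :=
    (hd.differentiableAt (ball_mem_nhds c hR)).hasFDerivAt
  have := Complex.dist_le_mul_div_pow_of_mapsTo_ball_of_isLittleO (f := g) (c := c) (z := z)
    (R₁ := R) (R₂ := 4 * C) (n := 1) hg (fun w hw => ?_) ?_ hz
  · simp only [dist_eq_norm, g, sub_self, map_zero, sub_zero] at this
    calc _ = ‖f z - L (z - c) - f c‖ := by congr 1; abel
      _ ≤ _ := this
  -- The constant `4 * C` is `C` for `f w`, `C` for `f c`, and `2 * C` for the linear part by the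
  -- Cauchy estimate.
  · rw [mem_closedBall, dist_eq_norm]
    have h1 := hC w hw
    have h2 := hC c (mem_ball_self hR)
    have h3 : ‖L (w - c)‖ ≤ 2 * C := by
      have hwc : ‖w - c‖ ≤ R := by rw [← dist_eq_norm]; exact (mem_ball.1 hw).le
      calc ‖L (w - c)‖ ≤ ‖L‖ * ‖w - c‖ := L.le_opNorm _
        _ ≤ 2 * C / R * R := by
          exact mul_le_mul hL hwc (norm_nonneg _) ((norm_nonneg L).trans hL)
        _ = 2 * C := by field_simp
    have h4 : g w - g c = f w - L (w - c) - f c := by simp [g]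
    rw [h4]
    linarith [norm_sub_le (f w - L (w - c)) (f c), norm_sub_le (f w) (L (w - c))]
  · have h := hfc.isLittleO.norm_right
    simp only [pow_one]
    refine h.congr_left fun w => ?_
    simp only [g, sub_self, map_zero, sub_zero]
    abel

/-- The Cauchy estimate on balls of half the radius makes the derivatives uniformly Cauchy, so the
limit can be differentiated term by term. -/
theorem differentiableAt_of_tendstoUniformlyOn [CompleteSpace F] {f : ℕ → E → F} {g : E → F}
    {c : E} {R : ℝ} (hR : 0 < R) (hf : ∀ n, DifferentiableOn ℂ (f n) (ball c R))
    (h : TendstoUniformlyOn f g atTop (ball c R)) : DifferentiableAt ℂ g c := by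
  have hsub : ∀ z ∈ ball c (R / 2), ball z (R / 2) ⊆ ball c R := fun z hz =>
    ball_subset_ball' (by rw [mem_ball] at hz; linarith)
  have hdiff : ∀ n, ∀ z ∈ ball c (R / 2), HasFDerivAt (f n) (fderiv ℂ (f n) z) z := fun n z hz =>
    ((hf n).differentiableAt (isOpen_ball.mem_nhds
      (ball_subset_ball (by linarith) hz))).hasFDerivAt
  have hC : UniformCauchySeqOn (fun n z => fderiv ℂ (f n) z) atTop (ball c (R / 2)) := by
    rw [Metric.uniformCauchySeqOn_iff]
    intro ε hε
    obtain ⟨N, hN⟩ := Metric.uniformCauchySeqOn_iff.1 h.uniformCauchySeqOn (ε * R / 8)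
      (by positivity)
    refine ⟨N, fun m hm n hn z hz => ?_⟩
    have h1 : fderiv ℂ (fun w => f m w - f n w) z = fderiv ℂ (f m) z - fderiv ℂ (f n) z :=
      ((hdiff m z hz).sub (hdiff n z hz)).fderiv
    rw [dist_eq_norm, ← h1]
    have := norm_fderiv_le_of_ball (f := fun w => f m w - f n w) (c := z) (R := R / 2)
      (C := ε * R / 8) (by positivity)
      (((hf m).sub (hf n)).mono (hsub z hz))
      (fun w hw => by
        rw [← dist_eq_norm]; exact (hN m hm n hn w (hsub z hz hw)).le)
    calc _ ≤ _ := this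
      _ = ε / 2 := by field_simp; norm_num
      _ < ε := by linarith
  have hlim : ∀ z ∈ ball c (R / 2), ∃ L, Tendsto (fun n => fderiv ℂ (f n) z) atTop (𝓝 L) :=
    fun z hz => cauchySeq_tendsto_of_complete (hC.cauchySeq hz)
  choose! g' hg' using hlim
  exact (hasFDerivAt_of_tendstoUniformlyOn isOpen_ball (hC.tendstoUniformlyOn_of_tendsto hg') hdiff
    (fun z hz => h.tendsto_at (ball_subset_ball (by linarith) hz))
    (mem_ball_self (by positivity))).differentiableAt

theorem exists_ball_bound {f : E → F} {U : Set E} (hU : IsOpen U) (hf : DifferentiableOn ℂ f U)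
    {c : E} (hc : c ∈ U) : ∃ R > 0, ∃ C, ball c R ⊆ U ∧ ∀ z ∈ ball c R, ‖f z‖ ≤ C := by
  have h1 : ∀ᶠ z in 𝓝 c, ‖f z‖ < ‖f c‖ + 1 :=
    (hf.continuousOn.continuousAt (hU.mem_nhds hc)).norm.eventually_lt continuousAt_const
      (by linarith)
  obtain ⟨R, hR, h⟩ := Metric.eventually_nhds_iff_ball.1 (h1.and (hU.mem_nhds hc))
  exact ⟨R, hR, _, fun z hz => (h z hz).2, fun z hz => (h z hz).1.le⟩

/-- Locally a directional derivative is the uniform limit of holomorphic difference quotients, the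
error being of the order of the step by the second order estimate. -/
theorem differentiableOn_fderiv_apply [CompleteSpace F] {f : E → F} {U : Set E} (hU : IsOpen U)
    (hf : DifferentiableOn ℂ f U) (X : E) :
    DifferentiableOn ℂ (fun z => fderiv ℂ f z X) U := by
  intro c hc
  obtain ⟨R, hR, C, hRU, hC⟩ := exists_ball_bound hU hf hc
  set r := R / 2 with hr
  have hr0 : 0 < r := by positivity
  -- Positive steps tending to zero, scaled so that the shift by `τ n • X` has norm less than `r`.
  set τ : ℕ → ℝ := fun n => r / (‖X‖ + 1) * (1 / ((n : ℝ) + 1)) with hτ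
  have hτ0 : ∀ n, 0 < τ n := fun n => by positivity
  have hτX : ∀ n, τ n * ‖X‖ < r := fun n => by
    have h1 : 1 / ((n : ℝ) + 1) ≤ 1 := by
      rw [div_le_one (by positivity)]
      have : (0 : ℝ) ≤ n := n.cast_nonneg
      linarith
    calc τ n * ‖X‖ ≤ r / (‖X‖ + 1) * 1 * ‖X‖ := by simp only [hτ]; gcongr
      _ < r := by
        rw [mul_one, div_mul_eq_mul_div, div_lt_iff₀ (by positivity)]
        nlinarith [norm_nonneg X]
  have hτlim : Tendsto τ atTop (𝓝 0) := by
    have := (tendsto_one_div_add_atTop_nhds_zero_nat (𝕜 := ℝ)).const_mul (r / (‖X‖ + 1))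
    rwa [mul_zero] at this
  have hmem : ∀ n, ∀ z ∈ ball c r, z + (τ n : ℂ) • X ∈ ball z r := fun n z hz => by
    rw [mem_ball, dist_eq_norm, add_sub_cancel_left, norm_smul, Complex.norm_real,
      Real.norm_of_nonneg (hτ0 n).le]
    exact hτX n
  have hsub : ∀ z ∈ ball c r, ball z r ⊆ ball c R := fun z hz =>
    ball_subset_ball' (by rw [mem_ball] at hz; linarith)
  refine (differentiableAt_of_tendstoUniformlyOn (R := r) hr0
    (f := fun n z => (τ n : ℂ)⁻¹ • (f (z + (τ n : ℂ) • X) - f z)) ?_ ?_).differentiableWithinAt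
  · intro n
    refine DifferentiableOn.const_smul (DifferentiableOn.sub ?_ ?_) _
    · exact (hf.mono hRU).comp (differentiableOn_id.add_const _)
        (fun z hz => hsub z hz (hmem n z hz))
    · exact hf.mono ((ball_subset_ball (by linarith)).trans hRU)
  · rw [Metric.tendstoUniformlyOn_iff]
    intro ε hε
    have hlim : Tendsto (fun n => τ n * (4 * C * (‖X‖ / r) ^ 2)) atTop (𝓝 0) := by
      simpa using hτlim.mul_const (4 * C * (‖X‖ / r) ^ 2)
    filter_upwards [hlim.eventually_lt_const hε] with n hn z hz
    have hτc : (τ n : ℂ) ≠ 0 := by exact_mod_cast (hτ0 n).ne'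
    have key := norm_sub_sub_fderiv_le (hf.mono ((hsub z hz).trans hRU))
      (fun w hw => hC w (hsub z hz hw)) (hmem n z hz)
    rw [add_sub_cancel_left, map_smul, norm_smul, Complex.norm_real,
      Real.norm_of_nonneg (hτ0 n).le] at key
    rw [dist_comm, dist_eq_norm]
    have e : (τ n : ℂ)⁻¹ • (f (z + (τ n : ℂ) • X) - f z) - fderiv ℂ f z X =
        (τ n : ℂ)⁻¹ • (f (z + (τ n : ℂ) • X) - f z - (τ n : ℂ) • fderiv ℂ f z X) := by
      rw [smul_sub _ (_ - _), inv_smul_smul₀ hτc]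
    rw [e, norm_smul, norm_inv, Complex.norm_real, Real.norm_of_nonneg (hτ0 n).le]
    calc _ ≤ (τ n)⁻¹ * (4 * C * (τ n * ‖X‖ / r) ^ 2) := by
          have := (hτ0 n).le
          gcongr
      _ = τ n * (4 * C * (‖X‖ / r) ^ 2) := by
          have := (hτ0 n).ne'
          field_simp
      _ < ε := hn

/-- The set of points near which `f` vanishes is open. It is closed in `U` because, in a ball
meeting it at `z`, every point `y` lies on a complex line through `z`, where the one variable
identity theorem applies. -/
theorem eqOn_zero_of_eventuallyEq_zero {f : E → F} [CompleteSpace F] {U : Set E} (hU : IsOpen U)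
    (hUc : IsPreconnected U) (hf : DifferentiableOn ℂ f U) {p : E} (hp : p ∈ U)
    (h0 : f =ᶠ[𝓝 p] 0) : EqOn f 0 U := by
  have hopen : IsOpen {z | f =ᶠ[𝓝 z] 0} := isOpen_setOfPred_eventually_nhds
  have hsub : U ⊆ {z | f =ᶠ[𝓝 z] 0} := by
    refine hUc.subset_of_closure_inter_subset hopen ⟨p, hp, h0⟩ ?_
    rintro c ⟨hc, hcU⟩
    obtain ⟨R, hR, hRU⟩ := Metric.isOpen_iff.1 hU c hcU
    obtain ⟨z, hzR, hz⟩ := (mem_closure_iff_nhds.1 hc) _ (ball_mem_nhds c hR)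
    refine Filter.mem_of_superset (ball_mem_nhds c hR) fun y hy => ?_
    set ℓ : ℂ → E := fun t => z + t • (y - z)
    have hℓ : Differentiable ℂ ℓ := by fun_prop
    set V := ℓ ⁻¹' ball c R
    have hV : IsOpen V := isOpen_ball.preimage hℓ.continuous
    have hVc : IsPreconnected V := by
      refine Convex.isPreconnected ?_
      intro a ha b hb s t hs ht hst
      have := (convex_ball c R) ha hb hs ht hst
      change ℓ _ ∈ ball c R
      convert this using 1
      obtain rfl : s = 1 - t := by linarith
      simp only [ℓ]
      rw [← Complex.coe_smul (1 - t), ← Complex.coe_smul t, ← Complex.coe_smul (1 - t),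
        ← Complex.coe_smul t]
      push_cast
      simp only [smul_eq_mul]
      module
    have han : AnalyticOnNhd ℂ (f ∘ ℓ) V :=
      ((hf.mono hRU).comp hℓ.differentiableOn (fun t ht => ht)).analyticOnNhd hV
    have h0V : (0 : ℂ) ∈ V := by simpa [V, ℓ] using hzR
    have h1V : (1 : ℂ) ∈ V := by simpa [V, ℓ] using hy
    have hev : f ∘ ℓ =ᶠ[𝓝 0] 0 := by
      have : Tendsto ℓ (𝓝 0) (𝓝 z) := by
        have := hℓ.continuous.tendsto 0
        simpa [ℓ] using this
      exact this.eventually hz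
    have := han.eqOn_zero_of_preconnected_of_eventuallyEq_zero hVc h0V hev h1V
    simpa [ℓ] using this
  exact fun z hz => (hsub hz).self_of_nhds

end Holomorphic

/-! ### Weak holomorphy and polarization in Hilbert spaces -/

section HilbertValued

variable {E H : Type*} [NormedAddCommGroup E] [NormedSpace ℂ E]
  [NormedAddCommGroup H] [InnerProductSpace ℂ H]

/-- The inequality is closed in `y`, so it extends to the closure of `S` and may be tested on `x`
itself. -/
theorem norm_le_of_forall_norm_inner_le {S : Submodule ℂ H} {x : H}
    (hx : x ∈ S.topologicalClosure) {M : ℝ} (hM : 0 ≤ M)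
    (h : ∀ y ∈ S, ‖inner ℂ y x‖ ≤ M * ‖y‖) : ‖x‖ ≤ M := by
  have hcl : IsClosed {y : H | ‖inner ℂ y x‖ ≤ M * ‖y‖} :=
    isClosed_le (by fun_prop) (by fun_prop)
  have hmem : ‖inner ℂ x x‖ ≤ M * ‖x‖ := closure_minimal (fun y hy => h y hy) hcl hx
  rw [inner_self_eq_norm_sq_to_K] at hmem
  simp only [Complex.coe_algebraMap, norm_pow, Complex.norm_real, norm_norm] at hmem
  rcases eq_or_ne x 0 with rfl | hx0
  · simpa using hM
  · nlinarith [norm_pos_iff.2 hx0]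

theorem eq_zero_of_forall_inner_eq_zero {S : Submodule ℂ H} {x : H}
    (hx : x ∈ S.topologicalClosure) (h : ∀ y ∈ S, inner ℂ y x = 0) : x = 0 :=
  norm_le_zero_iff.1 <| norm_le_of_forall_norm_inner_le hx le_rfl fun y hy => by simp [h y hy]

/-- Hahn–Banach, then Riesz, then projection onto the closure of `S`. The subspace need not be
closed, so the Bergman space never has to be shown complete. -/
theorem exists_inner_eq_of_bound [CompleteSpace H] (S : Submodule ℂ H) (ℓ : S →ₗ⋆[ℂ] ℂ) (M : ℝ)
    (hℓ : ∀ y, ‖ℓ y‖ ≤ M * ‖y‖) :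
    ∃ v ∈ S.topologicalClosure, ∀ y : S, inner ℂ (y : H) v = ℓ y := by
  let m : S →ₗ[ℂ] ℂ :=
    { toFun := fun y => conj (ℓ y)
      map_add' := fun a b => by simp
      map_smul' := fun a b => by simp }
  obtain ⟨g, hg, -⟩ := exists_extension_norm_eq S (m.mkContinuous M fun y => by simpa [m] using hℓ y)
  set v := (InnerProductSpace.toDual ℂ H).symm g
  have : IsClosed (S.topologicalClosure : Set H) := S.isClosed_topologicalClosure
  have : CompleteSpace S.topologicalClosure := this.completeSpace_coe
  refine ⟨S.topologicalClosure.starProjection v, Submodule.starProjection_apply_mem _ _,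
    fun y => ?_⟩
  rw [← Submodule.inner_starProjection_left_eq_right,
    Submodule.starProjection_eq_self_iff.2 (S.le_topologicalClosure y.2), ← inner_conj_symm,
    InnerProductSpace.toDual_symm_apply, hg]
  simp [m]

/-- Weakly holomorphic and locally bounded implies holomorphic. The derivative in direction `h` is
the Riesz vector of the weak derivatives, and the quadratic remainder estimate is uniform over `y`
in the unit ball of `S`, hence holds in norm. -/
theorem differentiableOn_of_inner [CompleteSpace H] {Φ : E → H} {U : Set E} (hU : IsOpen U)
    (S : Submodule ℂ H) (hS : ∀ z ∈ U, Φ z ∈ S.topologicalClosure)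
    (hloc : ∀ c ∈ U, ∃ R > 0, ∃ C, ball c R ⊆ U ∧ ∀ z ∈ ball c R, ‖Φ z‖ ≤ C)
    (hw : ∀ y ∈ S, DifferentiableOn ℂ (fun z => inner ℂ y (Φ z)) U) :
    DifferentiableOn ℂ Φ U := by
  intro c hc
  obtain ⟨R, hR, C, hRU, hC⟩ := hloc c hc
  have hC0 : 0 ≤ C := (norm_nonneg _).trans (hC c (mem_ball_self hR))
  have hdiff : ∀ y : S, DifferentiableAt ℂ (fun z => inner ℂ (y : H) (Φ z)) c := fun y =>
    (hw y y.2).differentiableAt (hU.mem_nhds hc)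
  have hb : ∀ y : S, ∀ z ∈ ball c R, ‖inner ℂ (y : H) (Φ z)‖ ≤ C * ‖y‖ := fun y z hz => by
    calc _ ≤ ‖(y : H)‖ * ‖Φ z‖ := norm_inner_le_norm _ _
      _ ≤ ‖(y : H)‖ * C := by have := hC z hz; gcongr
      _ = _ := by rw [mul_comm]; rfl
  let ℓ : E → S →ₗ⋆[ℂ] ℂ := fun h =>
    { toFun := fun y => fderiv ℂ (fun z => inner ℂ (y : H) (Φ z)) c h
      map_add' := fun a b => by
        have : (fun z => inner ℂ ((a + b : S) : H) (Φ z)) =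
          (fun z => inner ℂ (a : H) (Φ z)) + fun z => inner ℂ (b : H) (Φ z) := by
          ext z; simp
        rw [this, fderiv_add (hdiff a) (hdiff b)]; rfl
      map_smul' := fun t a => by
        have : (fun z => inner ℂ ((t • a : S) : H) (Φ z)) =
          fun z => (conj t) • inner ℂ (a : H) (Φ z) := by
          ext z; simp [mul_comm]
        rw [this, fderiv_fun_const_smul (hdiff a)]; rfl }
  have hℓ : ∀ h y, ‖ℓ h y‖ ≤ (2 * C / R * ‖h‖) * ‖y‖ := fun h y => by
    calc ‖ℓ h y‖ ≤ ‖fderiv ℂ (fun z => inner ℂ (y : H) (Φ z)) c‖ * ‖h‖ :=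
          ContinuousLinearMap.le_opNorm _ _
      _ ≤ 2 * (C * ‖y‖) / R * ‖h‖ := by
        gcongr
        exact norm_fderiv_le_of_ball hR ((hw y y.2).mono hRU) (hb y)
      _ = _ := by ring
  choose D hDmem hD using fun h => exists_inner_eq_of_bound S (ℓ h) _ (hℓ h)
  let L : E →L[ℂ] H := LinearMap.mkContinuous
    { toFun := D
      map_add' := fun a b => by
        refine sub_eq_zero.1 (eq_zero_of_forall_inner_eq_zero (S := S)
          (sub_mem (hDmem _) (add_mem (hDmem _) (hDmem _))) fun y hy => ?_)
        have h1 := hD (a + b) ⟨y, hy⟩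
        have h2 := hD a ⟨y, hy⟩
        have h3 := hD b ⟨y, hy⟩
        simp only [ℓ, LinearMap.coe_mk, AddHom.coe_mk, map_add] at h1 h2 h3
        rw [inner_sub_right, inner_add_right, h1, h2, h3, sub_self]
      map_smul' := fun t a => by
        refine sub_eq_zero.1 (eq_zero_of_forall_inner_eq_zero (S := S)
          (sub_mem (hDmem _) (Submodule.smul_mem _ _ (hDmem _))) fun y hy => ?_)
        have h1 := hD (t • a) ⟨y, hy⟩
        have h2 := hD a ⟨y, hy⟩
        simp only [ℓ, LinearMap.coe_mk, AddHom.coe_mk, map_smul] at h1 h2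
        rw [inner_sub_right, RingHom.id_apply, inner_smul_right, h1, h2, smul_eq_mul, sub_self] }
    (2 * C / R) fun h => norm_le_of_forall_norm_inner_le (hDmem h) (by positivity) fun y hy => by
      have := hℓ h ⟨y, hy⟩
      rw [← hD h ⟨y, hy⟩] at this
      exact this
  have hest : ∀ z ∈ ball c R, ‖Φ z - Φ c - L (z - c)‖ ≤ 4 * C * (‖z - c‖ / R) ^ 2 := fun z hz => by
    refine norm_le_of_forall_norm_inner_le (S := S)
      (sub_mem (sub_mem (hS z (hRU hz)) (hS c hc)) (hDmem _)) (by positivity) fun y hy => ?_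
    have h1 := norm_sub_sub_fderiv_le ((hw y hy).mono hRU) (hb ⟨y, hy⟩) hz
    have h2 : inner ℂ y (D (z - c)) = fderiv ℂ (fun z => inner ℂ y (Φ z)) c (z - c) :=
      hD (z - c) ⟨y, hy⟩
    rw [inner_sub_right, inner_sub_right, h2]
    calc _ ≤ _ := h1
      _ = 4 * C * (‖z - c‖ / R) ^ 2 * ‖y‖ := by simp only [Submodule.coe_norm]; ring
  have hder : HasFDerivAt Φ L c := by
    rw [hasFDerivAt_iff_isLittleO]
    have hO : (fun z => Φ z - Φ c - L (z - c)) =O[𝓝 c] fun z => ‖z - c‖ ^ 2 := by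
      refine Asymptotics.IsBigO.of_bound (4 * C / R ^ 2) ?_
      filter_upwards [ball_mem_nhds c hR] with z hz
      calc _ ≤ _ := hest z hz
        _ = _ := by rw [norm_pow, norm_norm]; ring
    refine hO.trans_isLittleO ?_
    have h0 : Tendsto (fun z => z - c) (𝓝 c) (𝓝 0) := by
      simpa using (tendsto_id (x := 𝓝 c)).sub_const c
    have := (Asymptotics.isLittleO_norm_pow_id (E' := E) one_lt_two).comp_tendsto h0
    exact this
  exact hder.differentiableAt.differentiableWithinAt

theorem differentiableAt_inner_conj_line {α β : E → H} {a b : E} {s : ℂ}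
    (hα : DifferentiableAt ℂ α (a + conj s • b)) (hβ : DifferentiableAt ℂ β (a + s • b)) :
    DifferentiableAt ℂ (fun t : ℂ => inner ℂ (α (a + conj t • b)) (β (a + t • b))) s := by
  have h1 : DifferentiableAt ℂ (fun t : ℂ => β (a + t • b)) s :=
    DifferentiableAt.comp s (f := fun t : ℂ => a + t • b) hβ (by fun_prop)
  have h2 : HasDerivAt (fun t : ℂ => α (a + t • b)) (fderiv ℂ α (a + conj s • b) b) (conj s) := by
    have := hα.hasFDerivAt.comp_hasDerivAt (conj s) (f := fun t : ℂ => a + t • b) (f' := b) (by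
      simpa using ((hasDerivAt_id (conj s)).smul_const b).const_add a)
    exact this
  set α' := fderiv ℂ α (a + conj s • b) b
  -- The inner product is conjugate linear in its first slot, which cancels the conjugation of `t`.
  -- Conjugation is isometric, so the little-o estimate is transported by comparing norms.
  have h3 : HasDerivAt (fun t : ℂ => innerSL ℂ (α (a + conj t • b))) (innerSL ℂ α') s := by
    rw [hasDerivAt_iff_isLittleO] at h2 ⊢
    have hc : Tendsto (fun t : ℂ => conj t) (𝓝 s) (𝓝 (conj s)) :=
      Complex.continuous_conj.tendsto s
    have h4 := h2.comp_tendsto hc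
    rw [← Asymptotics.isLittleO_norm_left, ← Asymptotics.isLittleO_norm_right] at h4 ⊢
    refine h4.congr (fun t => ?_) fun t => ?_
    · simp only [Function.comp]
      rw [← innerSL_apply_norm (𝕜 := ℂ), map_sub, map_sub, map_smulₛₗ]
      simp
    · simp only [Function.comp]
      rw [← map_sub, RCLike.norm_conj]
  exact h3.differentiableAt.clm_apply h1

/-- On the slice `t ↦ (a + t b, a + t̄ b)` the function `T` is holomorphic in `t`; real `t` give
diagonal points, so it vanishes there and hence for all `t` with `‖t‖ < 2`. -/
theorem eq_zero_of_eq_zero_on_diagonal {T : E → E → ℂ} {p : E} {ρ : ℝ}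
    (hT : ∀ a b : E, ∀ s : ℂ, a + s • b ∈ ball p (3 * ρ) → a + conj s • b ∈ ball p (3 * ρ) →
      DifferentiableAt ℂ (fun t : ℂ => T (a + t • b) (a + conj t • b)) s)
    (hdiag : ∀ z ∈ ball p (3 * ρ), T z z = 0) {z w : E} (hz : z ∈ ball p ρ) (hw : w ∈ ball p ρ) :
    T z w = 0 := by
  -- Chosen so that `t = I` gives the pair `(z, w)`. Both `a - p` and `b` have norm below `ρ`, so
  -- `‖t‖ < 2` stays in the ball of radius `3 * ρ`.
  set a : E := (2⁻¹ : ℂ) • (z + w) with ha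
  set b : E := (-Complex.I * 2⁻¹) • (z - w) with hb
  have hap : ‖a - p‖ < ρ := by
    have e : a - p = (2⁻¹ : ℂ) • ((z - p) + (w - p)) := by rw [ha]; module
    rw [mem_ball, dist_eq_norm] at hz hw
    rw [e, norm_smul]
    norm_num
    linarith [norm_add_le (z - p) (w - p)]
  have hbp : ‖b‖ < ρ := by
    have e : b = (-Complex.I * 2⁻¹) • ((z - p) - (w - p)) := by rw [hb]; module
    rw [mem_ball, dist_eq_norm] at hz hw
    rw [e, norm_smul]
    norm_num
    have := norm_sub_le (z - p) (w - p)
    rw [sub_sub_sub_cancel_right] at this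
    linarith
  have hmem : ∀ s : ℂ, ‖s‖ < 2 → a + s • b ∈ ball p (3 * ρ) := fun s hs => by
    rw [mem_ball, dist_eq_norm]
    calc ‖a + s • b - p‖ = ‖(a - p) + s • b‖ := by congr 1; abel
      _ ≤ ‖a - p‖ + ‖s‖ * ‖b‖ := by rw [← norm_smul]; exact norm_add_le _ _
      _ ≤ ‖a - p‖ + 2 * ‖b‖ := by gcongr
      _ < 3 * ρ := by linarith
  set g : ℂ → ℂ := fun t => T (a + t • b) (a + conj t • b)
  have hg : AnalyticOnNhd ℂ g (ball 0 2) := by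
    refine DifferentiableOn.analyticOnNhd (fun s hs => ?_) isOpen_ball
    rw [mem_ball_zero_iff] at hs
    exact (hT a b s (hmem s hs) (hmem _ (by rwa [RCLike.norm_conj]))).differentiableWithinAt
  have hreal : ∀ t : ℝ, |t| < 2 → g t = 0 := fun t ht => by
    simp only [g, Complex.conj_ofReal]
    exact hdiag _ (hmem _ (by simpa using ht))
  have hfreq : ∃ᶠ t in 𝓝[≠] (0 : ℂ), g t = 0 := by
    have h1 : Tendsto (fun n : ℕ => ((1 / ((n : ℝ) + 1) : ℝ) : ℂ)) atTop (𝓝[≠] 0) := by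
      refine tendsto_nhdsWithin_iff.2 ⟨?_, Eventually.of_forall fun n => ?_⟩
      · have : Tendsto (fun n : ℕ => ((1 / ((n : ℝ) + 1) : ℝ) : ℂ)) atTop (𝓝 ((0 : ℝ) : ℂ)) :=
          (Complex.continuous_ofReal.tendsto 0).comp (tendsto_one_div_add_atTop_nhds_zero_nat (𝕜 := ℝ))
        rwa [Complex.ofReal_zero] at this
      · have : (1 / ((n : ℝ) + 1)) ≠ 0 := by positivity
        exact Complex.ofReal_ne_zero.2 this
    refine h1.frequently (Frequently.of_forall fun n => hreal _ ?_)
    rw [abs_of_nonneg (by positivity), div_lt_iff₀ (by positivity)]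
    have : (0 : ℝ) ≤ n := n.cast_nonneg
    linarith
  have h0 := hg.eqOn_zero_of_preconnected_of_frequently_eq_zero
    (convex_ball (0 : ℂ) 2).isPreconnected (mem_ball_self two_pos) hfreq
    (show Complex.I ∈ ball (0 : ℂ) 2 by simp)
  have ez : a + Complex.I • b = z := by
    rw [ha, hb, smul_smul, ← mul_assoc, mul_neg, Complex.I_mul_I]; module
  have ew : a + conj Complex.I • b = w := by
    rw [ha, hb, smul_smul, ← mul_assoc, Complex.conj_I, neg_mul_neg, Complex.I_mul_I]; module
  simpa only [g, ez, ew, Pi.zero_apply] using h0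

end HilbertValued

/-! ### Calabi's rigidity for Gram kernels -/

section Rigidity

variable {E H H' : Type*} [NormedAddCommGroup E] [NormedSpace ℂ E]
  [NormedAddCommGroup H] [InnerProductSpace ℂ H]
  [NormedAddCommGroup H'] [InnerProductSpace ℂ H']

/-- The polarized Gram determinant of `A` and its derivatives; on the diagonal, divided by
`⟪A z, A z⟫ ^ 2`, it is the Levi form of `log ‖A‖ ^ 2`. -/
def gramForm (A : E → H) (z w X Y : E) : ℂ :=
  inner ℂ (fderiv ℂ A w Y) (fderiv ℂ A z X) * inner ℂ (A w) (A z) -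
    inner ℂ (fderiv ℂ A w Y) (A z) * inner ℂ (A w) (fderiv ℂ A z X)

theorem gramForm_add_left (A : E → H) (z w X X' Y : E) :
    gramForm A z w (X + X') Y = gramForm A z w X Y + gramForm A z w X' Y := by
  simp only [gramForm, map_add, inner_add_right]; ring

theorem gramForm_add_right (A : E → H) (z w X Y Y' : E) :
    gramForm A z w X (Y + Y') = gramForm A z w X Y + gramForm A z w X Y' := by
  simp only [gramForm, map_add, inner_add_left]; ring

theorem gramForm_smul_left (A : E → H) (z w X Y : E) (t : ℂ) :
    gramForm A z w (t • X) Y = t * gramForm A z w X Y := by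
  simp only [gramForm, map_smul, inner_smul_right]; ring

theorem gramForm_smul_right (A : E → H) (z w X Y : E) (t : ℂ) :
    gramForm A z w X (t • Y) = conj t * gramForm A z w X Y := by
  simp only [gramForm, map_smul, inner_smul_left]; ring

/-- Both sides are sesquilinear in the tangent vectors; a sesquilinear form is recovered from its
quadratic values at `X`, `Y`, `X + Y` and `X + I • Y`. -/
theorem gramForm_polarization {A : E → H} {B : E → H'} {z : E} {s t : ℂ}
    (h : ∀ X, gramForm A z z X X * s = gramForm B z z X X * t) (X Y : E) :
    gramForm A z z X Y * s = gramForm B z z X Y * t := by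
  have h1 := h (X + Y)
  have h2 := h (X + Complex.I • Y)
  have hX := h X
  have hY := h Y
  simp only [gramForm_add_left, gramForm_add_right, gramForm_smul_left, gramForm_smul_right,
    Complex.conj_I] at h1 h2
  linear_combination (1 / 2 : ℂ) * h1 + (Complex.I / 2) * h2 - (1 / 2 : ℂ) * (hX + hY)
    - (Complex.I / 2) * (hX + hY) + (1 / 2 : ℂ) *
      (gramForm A z z X Y * s - gramForm B z z X Y * t - (gramForm A z z Y X * s -
        gramForm B z z Y X * t) + Complex.I * (gramForm A z z Y Y * s - gramForm B z z Y Y * t)) *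
      Complex.I_sq

theorem hasFDerivAt_const_inner {A : E → H} {A' : E →L[ℂ] H} {z : E} (hA : HasFDerivAt A A' z)
    (v : H) : HasFDerivAt (fun z => inner ℂ v (A z)) (innerSL ℂ v ∘L A') z :=
  (innerSL ℂ v).hasFDerivAt.comp z hA

theorem differentiableOn_const_inner {A : E → H} {U : Set E} (hA : DifferentiableOn ℂ A U)
    (v : H) : DifferentiableOn ℂ (fun z => inner ℂ v (A z)) U :=
  (innerSL ℂ v).differentiable.comp_differentiableOn hA

theorem hasFDerivAt_div {f g : E → ℂ} {f' g' : E →L[ℂ] ℂ} {z : E} (hf : HasFDerivAt f f' z)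
    (hg : HasFDerivAt g g' z) (h0 : g z ≠ 0) :
    HasFDerivAt (fun z => f z / g z) ((g z)⁻¹ • f' - (f z / g z ^ 2) • g') z := by
  have h1 := hf.mul ((hasDerivAt_inv h0).comp_hasFDerivAt z hg)
  refine (h1.congr_fderiv ?_).congr_of_eventuallyEq (Eventually.of_forall fun x => ?_)
  · ext X
    simp [div_eq_mul_inv]
    ring
  · simp [div_eq_mul_inv]

theorem hasFDerivAt_inner_div_inner {A : E → H} {z : E} (hA : DifferentiableAt ℂ A z) (u v : H)
    (h0 : inner ℂ v (A z) ≠ 0) :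
    ∃ L : E →L[ℂ] ℂ, HasFDerivAt (fun z => inner ℂ u (A z) / inner ℂ v (A z)) L z ∧
      ∀ X, L X = (inner ℂ u (fderiv ℂ A z X) * inner ℂ v (A z) -
        inner ℂ u (A z) * inner ℂ v (fderiv ℂ A z X)) / inner ℂ v (A z) ^ 2 := by
  refine ⟨_, hasFDerivAt_div (hasFDerivAt_const_inner hA.hasFDerivAt u)
    (hasFDerivAt_const_inner hA.hasFDerivAt v) h0,
    fun X => ?_⟩
  simp
  field_simp

theorem exists_ball_inner_ne_zero {X : Type*} [PseudoMetricSpace X] {A : X → H} {U : Set X} (hU : IsOpen U)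
    (hA : ContinuousOn A U) {p : X} (hp : p ∈ U) (h0 : A p ≠ 0) :
    ∃ ρ > 0, ball p ρ ⊆ U ∧ ∀ z ∈ ball p ρ, ∀ w ∈ ball p ρ, inner ℂ (A w) (A z) ≠ 0 := by
  have hc : ContinuousAt A p := hA.continuousAt (hU.mem_nhds hp)
  have h1 : Tendsto (fun q : X × X => inner ℂ (A q.2) (A q.1)) (𝓝 p ×ˢ 𝓝 p)
      (𝓝 (inner ℂ (A p) (A p))) :=
    (hc.tendsto.comp tendsto_snd).inner (hc.tendsto.comp tendsto_fst)
  have h2 := h1.eventually_ne (inner_self_ne_zero.2 h0)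
  rw [nhds_prod_eq.symm, Metric.eventually_nhds_iff_ball] at h2
  obtain ⟨r, hr, h2⟩ := h2
  obtain ⟨R, hR, hRU⟩ := Metric.isOpen_iff.1 hU p hp
  refine ⟨min r R, lt_min hr hR, (ball_subset_ball (min_le_right _ _)).trans hRU,
    fun z hz w hw => h2 (z, w) ?_⟩
  rw [← ball_prod_same]
  exact ⟨ball_subset_ball (min_le_left _ _) hz, ball_subset_ball (min_le_left _ _) hw⟩

variable [CompleteSpace H] [CompleteSpace H']

theorem differentiableAt_gramForm_line {A : E → H} {U : Set E} (hU : IsOpen U)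
    (hA : DifferentiableOn ℂ A U) {a b : E} {s : ℂ} (h1 : a + s • b ∈ U)
    (h2 : a + conj s • b ∈ U) (X Y : E) :
    DifferentiableAt ℂ (fun t : ℂ => gramForm A (a + t • b) (a + conj t • b) X Y) s := by
  have hA1 := hA.differentiableAt (hU.mem_nhds h1)
  have hA2 := hA.differentiableAt (hU.mem_nhds h2)
  have hX := (differentiableOn_fderiv_apply hU hA X).differentiableAt (hU.mem_nhds h1)
  have hY := (differentiableOn_fderiv_apply hU hA Y).differentiableAt (hU.mem_nhds h2)
  exact ((differentiableAt_inner_conj_line hY hX).mul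
    (differentiableAt_inner_conj_line hA2 hA1)).sub
    ((differentiableAt_inner_conj_line hY hA1).mul (differentiableAt_inner_conj_line hA2 hX))

/-- Local form of Calabi's rigidity: Hilbert space valued holomorphic maps whose `log ‖·‖ ^ 2` have
the same Levi form have proportional normalized Gram kernels. -/
theorem exists_ball_inner_mul_eq {A : E → H} {B : E → H'} {U : Set E} (hU : IsOpen U)
    (hA : DifferentiableOn ℂ A U) (hB : DifferentiableOn ℂ B U) {p : E} (hp : p ∈ U)
    (hA0 : A p ≠ 0) (hB0 : B p ≠ 0)
    (h : ∀ z ∈ U, ∀ X, gramForm A z z X X * inner ℂ (B z) (B z) ^ 2 =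
      gramForm B z z X X * inner ℂ (A z) (A z) ^ 2) :
    ∃ ρ > 0, ball p ρ ⊆ U ∧ ∀ z ∈ ball p ρ, ∀ w ∈ ball p ρ,
      inner ℂ (A w) (A z) * inner ℂ (B p) (B z) * inner ℂ (B w) (B p) * inner ℂ (A p) (A p) =
      inner ℂ (B w) (B z) * inner ℂ (A p) (A z) * inner ℂ (A w) (A p) * inner ℂ (B p) (B p) := by
  obtain ⟨r₁, hr₁, hr₁U, hAne⟩ := exists_ball_inner_ne_zero hU hA.continuousOn hp hA0
  obtain ⟨r₂, hr₂, -, hBne⟩ := exists_ball_inner_ne_zero hU hB.continuousOn hp hB0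
  set ρ := min r₁ r₂ / 3 with hρ
  have hρ0 : 0 < ρ := by positivity
  have h3 : 3 * ρ = min r₁ r₂ := by rw [hρ]; ring
  have h3U : ball p (3 * ρ) ⊆ U := by
    rw [h3]; exact (ball_subset_ball (min_le_left _ _)).trans hr₁U
  have hsub : ball p ρ ⊆ ball p (3 * ρ) := ball_subset_ball (by linarith)
  replace hAne : ∀ z ∈ ball p ρ, ∀ w ∈ ball p ρ, inner ℂ (A w) (A z) ≠ 0 := fun z hz w hw =>
    hAne z (ball_subset_ball ((h3.trans_le (min_le_left _ _))) (hsub hz))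
      w (ball_subset_ball ((h3.trans_le (min_le_left _ _))) (hsub hw))
  replace hBne : ∀ z ∈ ball p ρ, ∀ w ∈ ball p ρ, inner ℂ (B w) (B z) ≠ 0 := fun z hz w hw =>
    hBne z (ball_subset_ball ((h3.trans_le (min_le_right _ _))) (hsub hz))
      w (ball_subset_ball ((h3.trans_le (min_le_right _ _))) (hsub hw))
  have hpp : p ∈ ball p ρ := mem_ball_self hρ0
  have hdA : ∀ z ∈ ball p ρ, DifferentiableAt ℂ A z := fun z hz =>
    hA.differentiableAt (hU.mem_nhds (h3U (hsub hz)))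
  have hdB : ∀ z ∈ ball p ρ, DifferentiableAt ℂ B z := fun z hz =>
    hB.differentiableAt (hU.mem_nhds (h3U (hsub hz)))
  -- Polarization twice: in the tangent vectors at each diagonal point, then in the base points off
  -- the diagonal.
  have hgram : ∀ X Y, ∀ z ∈ ball p ρ, ∀ w ∈ ball p ρ,
      gramForm A z w X Y * inner ℂ (B w) (B z) ^ 2 =
        gramForm B z w X Y * inner ℂ (A w) (A z) ^ 2 := by
    intro X Y z hz w hw
    refine sub_eq_zero.1 (eq_zero_of_eq_zero_on_diagonal (T := fun z w =>
      gramForm A z w X Y * inner ℂ (B w) (B z) ^ 2 - gramForm B z w X Y * inner ℂ (A w) (A z) ^ 2)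
      (p := p) (ρ := ρ) (fun a b s h1 h2 => ?_) (fun z hz => ?_) hz hw)
    · have hA1 := hA.differentiableAt (hU.mem_nhds (h3U h1))
      have hA2 := hA.differentiableAt (hU.mem_nhds (h3U h2))
      have hB1 := hB.differentiableAt (hU.mem_nhds (h3U h1))
      have hB2 := hB.differentiableAt (hU.mem_nhds (h3U h2))
      exact ((differentiableAt_gramForm_line hU hA (h3U h1) (h3U h2) X Y).mul
        ((differentiableAt_inner_conj_line hB2 hB1).pow 2)).sub
        ((differentiableAt_gramForm_line hU hB (h3U h1) (h3U h2) X Y).mul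
        ((differentiableAt_inner_conj_line hA2 hA1).pow 2))
    · exact sub_eq_zero.2 (gramForm_polarization (h z (h3U hz)) X Y)
  -- the logarithmic derivatives in the second variable differ by a function of that variable
  have hlog : ∀ Y, ∀ w ∈ ball p ρ, ∀ z ∈ ball p ρ,
      inner ℂ (fderiv ℂ A w Y) (A z) / inner ℂ (A w) (A z) -
        inner ℂ (fderiv ℂ B w Y) (B z) / inner ℂ (B w) (B z) =
      inner ℂ (fderiv ℂ A w Y) (A p) / inner ℂ (A w) (A p) -
        inner ℂ (fderiv ℂ B w Y) (B p) / inner ℂ (B w) (B p) := by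
    intro Y w hw z hz
    have hder : ∀ z ∈ ball p ρ, HasFDerivAt (fun z =>
        inner ℂ (fderiv ℂ A w Y) (A z) / inner ℂ (A w) (A z) -
          inner ℂ (fderiv ℂ B w Y) (B z) / inner ℂ (B w) (B z)) (0 : E →L[ℂ] ℂ) z := by
      intro z hz
      obtain ⟨L, hL, hLX⟩ := hasFDerivAt_inner_div_inner (hdA z hz) (fderiv ℂ A w Y) (A w)
        (hAne z hz w hw)
      obtain ⟨M, hM, hMX⟩ := hasFDerivAt_inner_div_inner (hdB z hz) (fderiv ℂ B w Y) (B w)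
        (hBne z hz w hw)
      refine (hL.sub hM).congr_fderiv ?_
      ext X
      rw [_root_.sub_apply, hLX, hMX, _root_.zero_apply, sub_eq_zero,
        div_eq_div_iff (pow_ne_zero _ (hAne z hz w hw)) (pow_ne_zero _ (hBne z hz w hw))]
      -- The `z`-derivative of each logarithmic derivative is the polarized Levi form, so `hgram`
      -- says exactly that their difference has zero derivative.
      exact hgram X Y z hz w hw
    refine (convex_ball p ρ).is_const_of_fderivWithin_eq_zero (𝕜 := ℂ)
      (f := fun z => inner ℂ (fderiv ℂ A w Y) (A z) / inner ℂ (A w) (A z) -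
          inner ℂ (fderiv ℂ B w Y) (B z) / inner ℂ (B w) (B z))
      (fun z hz => (hder z hz).differentiableAt.differentiableWithinAt) (fun z hz => ?_) hz hpp
    rw [fderivWithin_of_isOpen isOpen_ball hz, (hder z hz).fderiv]
  refine ⟨ρ, hρ0, hsub.trans h3U, fun z hz w hw => ?_⟩
  have hAc : ∀ z ∈ ball p ρ, ∀ w ∈ ball p ρ, inner ℂ (A z) (A w) ≠ 0 := fun z hz w hw =>
    hAne w hw z hz
  have hBc : ∀ z ∈ ball p ρ, ∀ w ∈ ball p ρ, inner ℂ (B z) (B w) ≠ 0 := fun z hz w hw =>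
    hBne w hw z hz
  -- The conjugate of the normalized quotient of the two kernels, so that it is holomorphic in `w`.
  -- Its derivative vanishes by the conjugate of `hlog`.
  set G : E → ℂ := fun w => inner ℂ (A z) (A w) / inner ℂ (A p) (A w) *
    (inner ℂ (B p) (B w) / inner ℂ (B z) (B w)) with hG
  have hder : ∀ w ∈ ball p ρ, HasFDerivAt G (0 : E →L[ℂ] ℂ) w := by
    intro w hw
    obtain ⟨L, hL, hLX⟩ := hasFDerivAt_inner_div_inner (hdA w hw) (A z) (A p) (hAc p hpp w hw)
    obtain ⟨M, hM, hMX⟩ := hasFDerivAt_inner_div_inner (hdB w hw) (B p) (B z) (hBc z hz w hw)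
    refine (hL.mul hM).congr_fderiv ?_
    ext Y
    have hl := congrArg conj (hlog Y w hw z hz)
    simp only [map_sub, map_div₀, inner_conj_symm] at hl
    have e1 := hAc p hpp w hw
    have e2 := hBc p hpp w hw
    have e3 := hAc z hz w hw
    have e4 := hBc z hz w hw
    simp only [_root_.add_apply, _root_.smul_apply, hLX, hMX,
      _root_.zero_apply, smul_eq_mul]
    field_simp at hl ⊢
    linear_combination hl
  have hconst : G w = G p := by
    refine (convex_ball p ρ).is_const_of_fderivWithin_eq_zero (𝕜 := ℂ) (f := G)
      (fun z hz => (hder z hz).differentiableAt.differentiableWithinAt) (fun z hz => ?_) hw hpp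
    rw [fderivWithin_of_isOpen isOpen_ball hz, (hder z hz).fderiv]
  have hl := congrArg conj hconst
  simp only [hG, map_mul, map_div₀, inner_conj_symm] at hl
  have e1 := hAne p hpp w hw
  have e2 := hAne p hpp p hpp
  have e3 := hBne z hz w hw
  have e4 := hBne z hz p hpp
  field_simp at hl
  linear_combination hl

/-- The identity is holomorphic in `z` for fixed `w`, so it extends from the ball to `U` for `w`
near `p`. It is symmetric under conjugation with `z` and `w` exchanged, so the same argument then
extends it in `w`. -/
theorem inner_mul_eq_of_gramForm_eq {A : E → H} {B : E → H'} {U : Set E} (hU : IsOpen U)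
    (hUc : IsPreconnected U)
    (hA : DifferentiableOn ℂ A U) (hB : DifferentiableOn ℂ B U) {p : E} (hp : p ∈ U)
    (hA0 : A p ≠ 0) (hB0 : B p ≠ 0)
    (h : ∀ z ∈ U, ∀ X, gramForm A z z X X * inner ℂ (B z) (B z) ^ 2 =
      gramForm B z z X X * inner ℂ (A z) (A z) ^ 2) {z w : E} (hz : z ∈ U) (hw : w ∈ U) :
    inner ℂ (A w) (A z) * inner ℂ (B p) (B z) * inner ℂ (B w) (B p) * inner ℂ (A p) (A p) =
      inner ℂ (B w) (B z) * inner ℂ (A p) (A z) * inner ℂ (A w) (A p) * inner ℂ (B p) (B p) := by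
  obtain ⟨ρ, hρ, hρU, hloc⟩ := exists_ball_inner_mul_eq hU hA hB hp hA0 hB0 h
  have hextend : ∀ w, (∀ z ∈ ball p ρ,
      inner ℂ (A w) (A z) * inner ℂ (B p) (B z) * inner ℂ (B w) (B p) * inner ℂ (A p) (A p) =
      inner ℂ (B w) (B z) * inner ℂ (A p) (A z) * inner ℂ (A w) (A p) * inner ℂ (B p) (B p)) →
      ∀ z ∈ U,
      inner ℂ (A w) (A z) * inner ℂ (B p) (B z) * inner ℂ (B w) (B p) * inner ℂ (A p) (A p) =
      inner ℂ (B w) (B z) * inner ℂ (A p) (A z) * inner ℂ (A w) (A p) * inner ℂ (B p) (B p) := by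
    intro w hw z hz
    have := eqOn_zero_of_eventuallyEq_zero hU hUc (f := fun z =>
      inner ℂ (A w) (A z) * inner ℂ (B p) (B z) * inner ℂ (B w) (B p) * inner ℂ (A p) (A p) -
      inner ℂ (B w) (B z) * inner ℂ (A p) (A z) * inner ℂ (A w) (A p) * inner ℂ (B p) (B p))
      (((((differentiableOn_const_inner hA _).mul (differentiableOn_const_inner hB _)).mul_const _).mul_const _).sub
        ((((differentiableOn_const_inner hB _).mul (differentiableOn_const_inner hA _)).mul_const _).mul_const _)) hp
      (Filter.mem_of_superset (ball_mem_nhds p hρ) fun z hz => sub_eq_zero.2 (hw z hz)) hz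
    exact sub_eq_zero.1 this
  refine hextend w (fun z hz => ?_) z hz
  have h1 := congrArg conj (hextend z (fun w hw => hloc w hw z hz) w hw)
  simp only [map_mul, inner_conj_symm] at h1
  linear_combination h1

end Rigidity

/-! ### The Bergman metric as a Gram determinant -/

section MetricFormula

variable {E H : Type*} [NormedAddCommGroup E] [NormedSpace ℂ E]
  [NormedAddCommGroup H] [InnerProductSpace ℂ H]

theorem gramForm_sum_left {ι : Type*} (s : Finset ι) (A : E → H) (z w : E) (X : ι → E) (Y : E) :
    gramForm A z w (∑ i ∈ s, X i) Y = ∑ i ∈ s, gramForm A z w (X i) Y :=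
  map_sum (AddMonoidHom.mk' (fun X => gramForm A z w X Y)
    fun X X' => gramForm_add_left A z w X X' Y) X s

theorem gramForm_sum_right {ι : Type*} (s : Finset ι) (A : E → H) (z w X : E) (Y : ι → E) :
    gramForm A z w X (∑ i ∈ s, Y i) = ∑ i ∈ s, gramForm A z w X (Y i) :=
  map_sum (AddMonoidHom.mk' (fun Y => gramForm A z w X Y)
    fun Y Y' => gramForm_add_right A z w X Y Y') Y s

theorem hasFDerivAt_real_inner {A B : E → H} {z : E} (hA : DifferentiableAt ℂ A z)
    (hB : DifferentiableAt ℂ B z) :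
    ∃ L : E →L[ℝ] ℂ, HasFDerivAt (fun z => inner ℂ (A z) (B z)) L z ∧
      ∀ X, L X = inner ℂ (A z) (fderiv ℂ B z X) + inner ℂ (fderiv ℂ A z X) (B z) :=
  ⟨_, (hA.hasFDerivAt.restrictScalars ℝ).inner ℂ (hB.hasFDerivAt.restrictScalars ℝ), fun _ => rfl⟩

theorem inner_self_im_eq_zero (v : H) : (inner ℂ v v : ℂ).im = 0 :=
  inner_self_im (𝕜 := ℂ) v

theorem hasFDerivAt_log_inner_self {A : E → H} {z : E} (hA : DifferentiableAt ℂ A z)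
    (h0 : A z ≠ 0) :
    ∃ L : E →L[ℝ] ℂ, HasFDerivAt (fun z => (Real.log (inner ℂ (A z) (A z) : ℂ).re : ℂ)) L z ∧
      ∀ X, L X = (inner ℂ (A z) (fderiv ℂ A z X) + inner ℂ (fderiv ℂ A z X) (A z)) /
        inner ℂ (A z) (A z) := by
  obtain ⟨M, hM, hMX⟩ := hasFDerivAt_real_inner hA hA
  have hre : (inner ℂ (A z) (A z) : ℂ) = ((inner ℂ (A z) (A z) : ℂ).re : ℂ) :=
    Complex.ext rfl (inner_self_im_eq_zero _)
  have hne : (inner ℂ (A z) (A z) : ℂ).re ≠ 0 := fun h => by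
    rw [h, Complex.ofReal_zero] at hre
    exact inner_self_ne_zero.2 h0 hre
  have h1 : HasFDerivAt (fun z => (inner ℂ (A z) (A z) : ℂ).re) (Complex.reCLM ∘L M) z :=
    Complex.reCLM.hasFDerivAt.comp z hM
  refine ⟨_, Complex.ofRealCLM.hasFDerivAt.comp z (h1.log hne), fun X => ?_⟩
  have h2 : inner ℂ (A z) (fderiv ℂ A z X) + inner ℂ (fderiv ℂ A z X) (A z) =
      (((inner ℂ (A z) (fderiv ℂ A z X) + inner ℂ (fderiv ℂ A z X) (A z) : ℂ).re : ℝ) : ℂ) := by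
    refine (Complex.conj_eq_iff_re.1 ?_).symm
    rw [map_add, inner_conj_symm, inner_conj_symm, add_comm]
  rw [h2]
  conv_rhs => rw [hre]
  simp [hMX, div_eq_inv_mul]
  ring

/-- Of the two terms in the real derivative of `log ⟪A, A⟫`, the Wirtinger combination keeps only
the one that differentiates the conjugate linear slot. -/
theorem dzbar_logKernel {n : ℕ} {D : Set (Fin n → ℂ)} {μ : (Fin n → ℂ) → ℝ} (hD : IsOpen D)
    {A : (Fin n → ℂ) → H} (hA : DifferentiableOn ℂ A D) (h0 : ∀ z ∈ D, A z ≠ 0)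
    (hK : ∀ z ∈ D, kernel D μ z z = inner ℂ (A z) (A z)) {z : Fin n → ℂ} (hz : z ∈ D)
    (j : Fin n) :
    dzbar j (logKernel D μ) z =
      inner ℂ (fderiv ℂ A z (Pi.single j 1)) (A z) / inner ℂ (A z) (A z) := by
  obtain ⟨L, hL, hLX⟩ := hasFDerivAt_log_inner_self (hA.differentiableAt (hD.mem_nhds hz)) (h0 z hz)
  have hev : logKernel D μ =ᶠ[𝓝 z] fun z => (Real.log (inner ℂ (A z) (A z) : ℂ).re : ℂ) :=
    Filter.mem_of_superset (hD.mem_nhds hz) fun w hw => by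
      change logKernel D μ w = _
      rw [logKernel, hK w hw]
  have hI : (Pi.single j Complex.I : Fin n → ℂ) = Complex.I • Pi.single j 1 := by
    rw [← Pi.single_smul, smul_eq_mul, mul_one]
  rw [dzbar, hev.fderiv_eq, hL.fderiv, hLX, hLX, hI, map_smul, inner_smul_left, inner_smul_right,
    Complex.conj_I]
  have : (inner ℂ (A z) (A z) : ℂ) ≠ 0 := inner_self_ne_zero.2 (h0 z hz)
  field_simp
  ring_nf
  simp only [Complex.I_sq]
  ring

theorem dz_dzbar_logKernel [CompleteSpace H] {n : ℕ} {D : Set (Fin n → ℂ)} {μ : (Fin n → ℂ) → ℝ}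
    (hD : IsOpen D)
    {A : (Fin n → ℂ) → H} (hA : DifferentiableOn ℂ A D) (h0 : ∀ z ∈ D, A z ≠ 0)
    (hK : ∀ z ∈ D, kernel D μ z z = inner ℂ (A z) (A z)) {z : Fin n → ℂ} (hz : z ∈ D)
    (i j : Fin n) :
    dz i (dzbar j (logKernel D μ)) z =
      gramForm A z z (Pi.single i 1) (Pi.single j 1) / inner ℂ (A z) (A z) ^ 2 := by
  have hev : dzbar j (logKernel D μ) =ᶠ[𝓝 z] fun z =>
      inner ℂ (fderiv ℂ A z (Pi.single j 1)) (A z) / inner ℂ (A z) (A z) :=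
    Filter.mem_of_superset (hD.mem_nhds hz) fun w hw => dzbar_logKernel hD hA h0 hK hw j
  have hAz := hA.differentiableAt (hD.mem_nhds hz)
  obtain ⟨M, hM, hMX⟩ := hasFDerivAt_real_inner hAz hAz
  obtain ⟨N, hN, hNX⟩ := hasFDerivAt_real_inner
    ((differentiableOn_fderiv_apply hD hA (Pi.single j 1)).differentiableAt (hD.mem_nhds hz)) hAz
  have hne : (inner ℂ (A z) (A z) : ℂ) ≠ 0 := inner_self_ne_zero.2 (h0 z hz)
  have hder := hN.mul (((hasDerivAt_inv hne).hasFDerivAt.restrictScalars ℝ).comp z hM)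
  have hev2 : dzbar j (logKernel D μ) =ᶠ[𝓝 z] ((fun z =>
      inner ℂ (fderiv ℂ A z (Pi.single j 1)) (A z)) *
        ((fun x : ℂ => x⁻¹) ∘ fun z => inner ℂ (A z) (A z))) :=
    hev.trans (Eventually.of_forall fun w => div_eq_mul_inv _ _)
  have hI : (Pi.single i Complex.I : Fin n → ℂ) = Complex.I • Pi.single i 1 := by
    rw [← Pi.single_smul, smul_eq_mul, mul_one]
  rw [dz, hev2.fderiv_eq, hder.fderiv, hI]
  simp only [_root_.add_apply, _root_.smul_apply, ContinuousLinearMap.comp_apply,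
    ContinuousLinearMap.coe_restrictScalars', hMX, hNX, map_smul, inner_smul_left,
    inner_smul_right, Complex.conj_I, gramForm, ContinuousLinearMap.toSpanSingleton_apply,
    smul_eq_mul, Function.comp]
  field_simp
  ring_nf
  simp only [Complex.I_sq]
  ring

theorem metricNormSq_eq_gramForm [CompleteSpace H] {n : ℕ} {D : Set (Fin n → ℂ)}
    {μ : (Fin n → ℂ) → ℝ} (hD : IsOpen D)
    {A : (Fin n → ℂ) → H} (hA : DifferentiableOn ℂ A D) (h0 : ∀ z ∈ D, A z ≠ 0)
    (hK : ∀ z ∈ D, kernel D μ z z = inner ℂ (A z) (A z)) {z : Fin n → ℂ} (hz : z ∈ D)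
    (X : Fin n → ℂ) :
    metricNormSq D μ z X = gramForm A z z X X / inner ℂ (A z) (A z) ^ 2 := by
  have hX : X = ∑ i, X i • (Pi.single i 1 : Fin n → ℂ) := by
    conv_lhs => rw [← Finset.univ_sum_single X]
    refine Finset.sum_congr rfl fun i _ => ?_
    rw [← Pi.single_smul, smul_eq_mul, mul_one]
  have h1 : gramForm A z z X X = ∑ i, ∑ j, X i * (conj (X j) *
      gramForm A z z (Pi.single i 1) (Pi.single j 1)) := by
    conv_lhs => rw [hX]
    rw [gramForm_sum_left]
    refine Finset.sum_congr rfl fun i _ => ?_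
    rw [gramForm_sum_right]
    refine Finset.sum_congr rfl fun j _ => ?_
    rw [gramForm_smul_left, gramForm_smul_right]
  rw [metricNormSq, h1, Finset.sum_div]
  refine Finset.sum_congr rfl fun i _ => ?_
  rw [Finset.sum_div]
  refine Finset.sum_congr rfl fun j _ => ?_
  rw [dz_dzbar_logKernel hD hA h0 hK hz]
  ring

end MetricFormula

/-! ### Mean value property on polydiscs -/

section MeanValue

variable {n : ℕ}

theorem measurePreserving_circle_smul {a : ℂ} (ha : ‖a‖ = 1) :
    MeasurePreserving (fun ζ : Fin n → ℂ => a • ζ) volume volume := by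
  have h1 : MeasurePreserving (fun ζ : ℂ => a * ζ) volume volume :=
    (rotation ⟨a, by simpa [Submonoid.unitSphere] using ha⟩).measurePreserving
  exact volume_preserving_pi (f := fun _ : Fin n => fun ζ : ℂ => a * ζ) fun _ => h1

theorem setIntegral_ball_smul {a : ℂ} (ha : ‖a‖ = 1) (f : (Fin n → ℂ) → ℂ) (r : ℝ) :
    ∫ ζ in ball 0 r, f (a • ζ) = ∫ ζ in ball 0 r, f ζ := by
  have ha0 : a ≠ 0 := fun h => by simp [h] at ha
  have hpre : (fun ζ : Fin n → ℂ => a • ζ) ⁻¹' ball 0 r = ball 0 r := by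
    ext ζ
    simp [norm_smul, ha]
  have hemb : MeasurableEmbedding (fun ζ : Fin n → ℂ => a • ζ) :=
    (Homeomorph.smulOfNeZero a ha0).measurableEmbedding
  conv_lhs => rw [← hpre]
  exact (measurePreserving_circle_smul ha).setIntegral_preimage_emb hemb _ _

/-- Mean value property over polydiscs. -/
theorem setIntegral_ball_eq {g : (Fin n → ℂ) → ℂ} {D : Set (Fin n → ℂ)} (hD : IsOpen D)
    (hg : DifferentiableOn ℂ g D) {w : Fin n → ℂ} {r : ℝ} (hr : closedBall w r ⊆ D) :
    ∫ ζ in ball w r, g ζ = volume.real (ball w r) * g w := by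
  set B : Set (Fin n → ℂ) := ball 0 r
  have htrans : ∀ f : (Fin n → ℂ) → ℂ, ∫ ζ in ball w r, f ζ = ∫ ζ in B, f (w + ζ) := fun f => by
    have hpre : (fun ζ => w + ζ) ⁻¹' ball w r = B := by
      ext ζ; simp [B, dist_eq_norm]
    rw [← hpre]
    exact ((measurePreserving_add_left volume w).setIntegral_preimage_emb
      (measurableEmbedding_addLeft w) f _).symm
  have hvol : volume.real (ball w r) = volume.real B := by
    rw [Measure.real, Measure.real, Measure.addHaar_ball_center]
  have hmem : ∀ t : ℂ, ‖t‖ ≤ 1 → ∀ ζ ∈ B, w + t • ζ ∈ closedBall w r := fun t ht ζ hζ => by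
    rw [mem_ball_zero_iff] at hζ
    rw [mem_closedBall, dist_eq_norm, add_sub_cancel_left, norm_smul]
    nlinarith [norm_nonneg t, norm_nonneg ζ]
  have hcirc : ∀ θ : ℝ, ‖circleMap 0 1 θ‖ = 1 := fun θ => by simp
  obtain ⟨C, hC⟩ := (isCompact_closedBall w r).exists_bound_of_continuousOn
    (hg.continuousOn.mono hr)
  -- Rotating all coordinates by one angle `θ` preserves the polydisc and its volume. Averaging over
  -- `θ` and exchanging integrals reduces the claim to the one variable mean value property of `t ↦
  -- g (w + t • ζ)`.
  set F : ℝ → (Fin n → ℂ) → ℂ := fun θ ζ => g (w + circleMap 0 1 θ • ζ)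
  have hFcont : ContinuousOn (Function.uncurry F) (univ ×ˢ B) := by
    refine (hg.continuousOn.mono hr).comp (t := closedBall w r) ?_ fun q hq =>
      hmem _ (hcirc _).le _ hq.2
    have : Continuous (circleMap 0 1) := continuous_circleMap 0 1
    fun_prop
  have hint : Integrable (Function.uncurry F)
      ((volume.restrict (Ioc 0 (2 * Real.pi))).prod (volume.restrict B)) := by
    rw [Measure.prod_restrict]
    have : IsFiniteMeasure ((volume.prod volume).restrict
        (Ioc 0 (2 * Real.pi) ×ˢ B)) := ⟨by
      rw [Measure.restrict_apply_univ, Measure.prod_prod]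
      exact ENNReal.mul_lt_top measure_Ioc_lt_top measure_ball_lt_top⟩
    refine Integrable.of_bound (C := C) ?_ ?_
    · exact (hFcont.mono (prod_mono (subset_univ _) subset_rfl)).aestronglyMeasurable
        (measurableSet_Ioc.prod measurableSet_ball)
    · refine (ae_restrict_iff' (measurableSet_Ioc.prod measurableSet_ball)).2
        (Eventually.of_forall fun q hq => hC _ (hmem _ (hcirc _).le _ hq.2))
  have hswap := integral_integral_swap hint
  have h1 : ∀ θ, ∫ ζ in B, F θ ζ = ∫ ζ in B, g (w + ζ) := fun θ =>
    setIntegral_ball_smul (hcirc θ) (fun ζ => g (w + ζ)) r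
  have h2 : ∀ ζ ∈ B, ∫ θ in Ioc 0 (2 * Real.pi), F θ ζ = 2 * Real.pi * g w := fun ζ hζ => by
    have hd : DiffContOnCl ℂ (fun t : ℂ => g (w + t • ζ)) (ball 0 |1|) := by
      refine DifferentiableOn.diffContOnCl ?_
      rw [abs_one, closure_ball _ one_ne_zero]
      intro t ht
      rw [mem_closedBall_zero_iff] at ht
      exact ((hg.differentiableAt (hD.mem_nhds (hr (hmem t ht ζ hζ)))).comp t
        (f := fun t : ℂ => w + t • ζ) (by fun_prop)).differentiableWithinAt
    have := hd.circleAverage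
    rw [Real.circleAverage_def, intervalIntegral.integral_of_le Real.two_pi_pos.le, zero_smul,
      add_zero, inv_smul_eq_iff₀ Real.two_pi_pos.ne'] at this
    rw [this]
    simp
  simp only [h1] at hswap
  rw [setIntegral_congr_fun measurableSet_ball h2] at hswap
  simp only [integral_const, measureReal_restrict_apply_univ, Real.volume_real_Ioc] at hswap
  rw [htrans, hvol]
  have hpi : (Real.pi : ℂ) ≠ 0 := by exact_mod_cast Real.pi_ne_zero
  have hmax : max (2 * Real.pi - 0) 0 = 2 * Real.pi := by
    rw [sub_zero]; exact max_eq_left Real.two_pi_pos.le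
  rw [hmax] at hswap
  simp only [Complex.real_smul] at hswap
  push_cast at hswap
  have h2pi : (2 * Real.pi : ℂ) ≠ 0 := mul_ne_zero two_ne_zero hpi
  apply mul_left_cancel₀ h2pi
  rw [hswap]; ring

end MeanValue

/-! ### Bounded point evaluations -/

section BergmanSpace

variable {n : ℕ} {D : Set (Fin n → ℂ)} {μ : (Fin n → ℂ) → ℝ}

theorem IsPositiveContinuousWeight.aemeasurable (hD : IsOpen D)
    (hμ : IsPositiveContinuousWeight D μ) :
    AEMeasurable (fun z => ENNReal.ofReal (μ z)) (volume.restrict D) :=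
  ((hμ.continuousOn.mono subset_closure).aemeasurable hD.measurableSet).ennreal_ofReal

theorem restrict_absolutelyContinuous (hD : IsOpen D) (hμ : IsPositiveContinuousWeight D μ) :
    volume.restrict D ≪ weightedVolume D μ := by
  refine withDensity_absolutelyContinuous' (hμ.aemeasurable hD) ?_
  refine (ae_restrict_iff' hD.measurableSet).2 (Eventually.of_forall fun z hz => ?_)
  exact (ENNReal.ofReal_pos.2 (hμ.pos z (subset_closure hz))).ne'

theorem eqOn_of_ae_eq_weightedVolume (hD : IsOpen D) (hμ : IsPositiveContinuousWeight D μ)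
    {g h : (Fin n → ℂ) → ℂ} (hg : ContinuousOn g D) (hh : ContinuousOn h D)
    (hgh : g =ᵐ[weightedVolume D μ] h) : EqOn g h D :=
  Measure.eqOn_open_of_ae_eq ((restrict_absolutelyContinuous hD hμ).ae_eq hgh) hD hg hh

theorem ae_weightedVolume_mem (hD : IsOpen D) : ∀ᵐ z ∂weightedVolume D μ, z ∈ D :=
  (withDensity_absolutelyContinuous _ _).ae_le (ae_restrict_mem hD.measurableSet)

theorem isFiniteMeasure_weightedVolume (hD : Bornology.IsBounded D)
    (hμ : IsPositiveContinuousWeight D μ) : IsFiniteMeasure (weightedVolume D μ) := by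
  have hcpt : IsCompact (closure D) := hD.isCompact_closure
  obtain ⟨C, hC⟩ := hcpt.exists_bound_of_continuousOn hμ.continuousOn
  refine isFiniteMeasure_withDensity (ne_of_lt ?_)
  calc ∫⁻ z in D, ENNReal.ofReal (μ z) ≤ ∫⁻ _ in D, ENNReal.ofReal C := by
        refine setLIntegral_mono measurable_const fun z hz => ENNReal.ofReal_le_ofReal ?_
        exact (le_abs_self _).trans (hC z (subset_closure hz))
    _ < ⊤ := by
        rw [setLIntegral_const]
        exact ENNReal.mul_lt_top ENNReal.ofReal_lt_top hD.measure_lt_top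

theorem smul_restrict_le_weightedVolume {B : Set (Fin n → ℂ)}
    (hB : MeasurableSet B) (hBD : B ⊆ D) {m : ℝ} (hm : ∀ z ∈ B, m ≤ μ z) :
    ENNReal.ofReal m • volume.restrict B ≤ weightedVolume D μ := by
  have h1 : (volume.restrict D).withDensity (B.indicator fun _ => ENNReal.ofReal m) ≤
      weightedVolume D μ := by
    refine withDensity_mono (Eventually.of_forall fun z => ?_)
    by_cases hz : z ∈ B
    · simpa [hz] using ENNReal.ofReal_le_ofReal (hm z hz)
    · simp [hz]
  rwa [withDensity_indicator hB, withDensity_const, Measure.restrict_restrict hB,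
    inter_eq_left.2 hBD] at h1

/-- The mean value property and Cauchy–Schwarz on a polydisc around `w`, with the weight bounded
below by its minimum on a compact ball. The constant is uniform for `w` near `c`, which later gives
local boundedness of the representing map. -/
theorem exists_eval_bound (hD : IsOpen D) (hμ : IsPositiveContinuousWeight D μ) {c : Fin n → ℂ}
    (hc : c ∈ D) : ∃ R > 0, ∃ C : ℝ, 0 ≤ C ∧ ball c R ⊆ D ∧ ∀ w ∈ ball c R,
      ∀ g ∈ bergmanSpace D μ, ‖g w‖ ≤ C * (eLpNorm g 2 (weightedVolume D μ)).toReal := by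
  obtain ⟨R, hR, hRD⟩ := Metric.nhds_basis_closedBall.mem_iff.1 (hD.mem_nhds hc)
  have hcont : ContinuousOn μ (closedBall c R) :=
    hμ.continuousOn.mono (hRD.trans subset_closure)
  obtain ⟨z₀, hz₀, hmin⟩ := (isCompact_closedBall c R).exists_isMinOn
    ⟨c, mem_closedBall_self hR.le⟩ hcont
  have hm : 0 < μ z₀ := hμ.pos _ (subset_closure (hRD hz₀))
  set V := volume (ball (0 : Fin n → ℂ) (R / 2)) with hV
  have hV0 : V ≠ 0 := (measure_ball_pos _ _ (by positivity)).ne'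
  have hVt : V ≠ ⊤ := measure_ball_lt_top.ne
  set K : ENNReal := V⁻¹ * (V ^ (1 / 2 : ℝ) * (ENNReal.ofReal (μ z₀))⁻¹ ^ (1 / 2 : ℝ)) with hK
  have hKt : K ≠ ⊤ := by
    refine ENNReal.mul_ne_top (ENNReal.inv_ne_top.2 hV0) (ENNReal.mul_ne_top ?_ ?_)
    · exact ENNReal.rpow_ne_top_of_nonneg (by norm_num) hVt
    · exact ENNReal.rpow_ne_top_of_nonneg (by norm_num)
        (ENNReal.inv_ne_top.2 (ENNReal.ofReal_pos.2 hm).ne')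
  refine ⟨R / 2, by positivity, K.toReal, ENNReal.toReal_nonneg,
    (ball_subset_closedBall.trans (closedBall_subset_closedBall (by linarith))).trans hRD,
    fun w hw g hg => ?_⟩
  have hsub : closedBall w (R / 2) ⊆ closedBall c R :=
    closedBall_subset_closedBall' (by rw [mem_ball] at hw; linarith)
  have hsubD : ball w (R / 2) ⊆ D := (ball_subset_closedBall.trans hsub).trans hRD
  have hVw : volume (ball w (R / 2)) = V := Measure.addHaar_ball_center _ _ _
  have hmean := setIntegral_ball_eq hD hg.1 (hsub.trans hRD)
  have hle := smul_restrict_le_weightedVolume (μ := μ) measurableSet_ball hsubD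
    (m := μ z₀) fun z hz => hmin (hsub (ball_subset_closedBall hz))
  have hmeas : AEStronglyMeasurable g (volume.restrict (ball w (R / 2))) :=
    (hg.1.continuousOn.mono hsubD).aestronglyMeasurable measurableSet_ball
  have hm' : ENNReal.ofReal (μ z₀) ≠ 0 := (ENNReal.ofReal_pos.2 hm).ne'
  have h1 : V * ‖g w‖ₑ ≤ V ^ (1 / 2 : ℝ) * ((ENNReal.ofReal (μ z₀))⁻¹ ^ (1 / 2 : ℝ) *
      eLpNorm g 2 (weightedVolume D μ)) := by
    calc V * ‖g w‖ₑ = ‖∫ ζ in ball w (R / 2), g ζ‖ₑ := by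
          rw [hmean, enorm_mul, Measure.real, hVw]
          congr 1
          rw [← ofReal_norm, Complex.norm_real, Real.norm_of_nonneg ENNReal.toReal_nonneg,
            ENNReal.ofReal_toReal hVt]
      _ ≤ ∫⁻ ζ in ball w (R / 2), ‖g ζ‖ₑ := enorm_integral_le_lintegral_enorm _
      _ = eLpNorm g 1 (volume.restrict (ball w (R / 2))) := (eLpNorm_one_eq_lintegral_enorm (f := g)).symm
      _ ≤ eLpNorm g 2 (volume.restrict (ball w (R / 2))) *
          (volume.restrict (ball w (R / 2))) univ ^ (1 / (1 : ENNReal).toReal -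
            1 / (2 : ENNReal).toReal) :=
        eLpNorm_le_eLpNorm_mul_rpow_measure_univ (by norm_num) hmeas
      _ = V ^ (1 / 2 : ℝ) * eLpNorm g 2 (volume.restrict (ball w (R / 2))) := by
        rw [Measure.restrict_apply_univ, hVw, mul_comm]
        norm_num
      _ ≤ V ^ (1 / 2 : ℝ) * eLpNorm g 2
          ((ENNReal.ofReal (μ z₀))⁻¹ • weightedVolume D μ) := by
        gcongr
        calc volume.restrict (ball w (R / 2)) = (ENNReal.ofReal (μ z₀))⁻¹ •
              (ENNReal.ofReal (μ z₀) • volume.restrict (ball w (R / 2))) := by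
              rw [smul_smul, ENNReal.inv_mul_cancel hm' ENNReal.ofReal_ne_top, one_smul]
          _ ≤ _ := by
            refine Measure.le_iff'.2 fun s => ?_
            simp only [Measure.smul_apply, smul_eq_mul]
            have := hle s
            simp only [Measure.smul_apply, smul_eq_mul] at this
            exact mul_le_mul_right this _
      _ = _ := by
        rw [eLpNorm_smul_measure_of_ne_top (by norm_num)]
        norm_num
  have h2 : ‖g w‖ₑ ≤ K * eLpNorm g 2 (weightedVolume D μ) := by
    calc ‖g w‖ₑ = V⁻¹ * (V * ‖g w‖ₑ) := by
          rw [← mul_assoc, ENNReal.inv_mul_cancel hV0 hVt, one_mul]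
      _ ≤ V⁻¹ * (V ^ (1 / 2 : ℝ) * ((ENNReal.ofReal (μ z₀))⁻¹ ^ (1 / 2 : ℝ) *
          eLpNorm g 2 (weightedVolume D μ))) := by gcongr
      _ = _ := by rw [hK]; ring
  have h3 := ENNReal.toReal_mono (ENNReal.mul_ne_top hKt hg.2.2.ne) h2
  rwa [toReal_enorm, ENNReal.toReal_mul] at h3

end BergmanSpace

/-! ### The kernel as a Gram kernel -/

section Kernel

variable {n : ℕ} {D : Set (Fin n → ℂ)} {μ : (Fin n → ℂ) → ℝ}

/-- The space of (classes of) conjugates of functions in the weighted Bergman space. -/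
def conjBergman (D : Set (Fin n → ℂ)) (μ : (Fin n → ℂ) → ℝ) :
    Submodule ℂ (Lp ℂ 2 (weightedVolume D μ)) where
  carrier := {x | ∃ g ∈ bergmanSpace D μ, x =ᵐ[weightedVolume D μ] fun z => conj (g z)}
  add_mem' := by
    rintro x y ⟨g, hg, hxg⟩ ⟨h, hh, hyh⟩
    refine ⟨g + h, ⟨hg.1.add hh.1, hg.2.add hh.2⟩, ?_⟩
    filter_upwards [Lp.coeFn_add x y, hxg, hyh] with z h1 h2 h3
    rw [h1, Pi.add_apply, h2, h3, Pi.add_apply, map_add]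
  zero_mem' := by
    refine ⟨0, ⟨differentiableOn_const 0, MemLp.zero⟩, ?_⟩
    filter_upwards [Lp.coeFn_zero ℂ 2 (weightedVolume D μ)] with z h1
    rw [h1]; simp
  smul_mem' := by
    rintro t x ⟨g, hg, hxg⟩
    refine ⟨conj t • g, ⟨hg.1.const_smul _, hg.2.const_smul _⟩, ?_⟩
    filter_upwards [Lp.coeFn_smul t x, hxg] with z h1 h2
    rw [h1, Pi.smul_apply, h2, Pi.smul_apply, smul_eq_mul, smul_eq_mul, map_mul, Complex.conj_conj]

theorem memLp_conj {g : (Fin n → ℂ) → ℂ} {ν : Measure (Fin n → ℂ)} (hg : MemLp g 2 ν) :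
    MemLp (fun z => conj (g z)) 2 ν :=
  hg.congr_norm (Complex.continuous_conj.comp_aestronglyMeasurable hg.1)
    (Eventually.of_forall fun _ => (RCLike.norm_conj _).symm)

/-- The holomorphic function whose conjugate represents an element of `conjBergman`. -/
def rep (y : conjBergman D μ) : (Fin n → ℂ) → ℂ := y.2.choose

theorem rep_mem (y : conjBergman D μ) : rep y ∈ bergmanSpace D μ := y.2.choose_spec.1

theorem coeFn_ae_eq_rep (y : conjBergman D μ) :
    (y : Lp ℂ 2 (weightedVolume D μ)) =ᵐ[weightedVolume D μ] fun z => conj (rep y z) :=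
  y.2.choose_spec.2

theorem rep_eqOn (hD : IsOpen D) (hμ : IsPositiveContinuousWeight D μ) (y : conjBergman D μ)
    {g : (Fin n → ℂ) → ℂ} (hg : ContinuousOn g D)
    (h : (y : Lp ℂ 2 (weightedVolume D μ)) =ᵐ[weightedVolume D μ] fun z => conj (g z)) :
    EqOn (rep y) g D := by
  refine eqOn_of_ae_eq_weightedVolume hD hμ (rep_mem y).1.continuousOn hg ?_
  filter_upwards [coeFn_ae_eq_rep y, h] with z h1 h2
  rw [h1] at h2
  exact (starRingEnd ℂ).injective h2

/-- The element of `conjBergman` given by a function of the Bergman space. -/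
def toConjBergman {g : (Fin n → ℂ) → ℂ} (hg : g ∈ bergmanSpace D μ) : conjBergman D μ :=
  ⟨(memLp_conj hg.2).toLp _, g, hg, (memLp_conj hg.2).coeFn_toLp⟩

theorem coeFn_toConjBergman {g : (Fin n → ℂ) → ℂ} (hg : g ∈ bergmanSpace D μ) :
    (toConjBergman hg : Lp ℂ 2 (weightedVolume D μ)) =ᵐ[weightedVolume D μ]
      fun z => conj (g z) :=
  (memLp_conj hg.2).coeFn_toLp

theorem rep_toConjBergman (hD : IsOpen D) (hμ : IsPositiveContinuousWeight D μ)
    {g : (Fin n → ℂ) → ℂ} (hg : g ∈ bergmanSpace D μ) : EqOn (rep (toConjBergman hg)) g D :=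
  rep_eqOn hD hμ _ hg.1.continuousOn (coeFn_toConjBergman hg)

theorem norm_eq_eLpNorm_rep (y : conjBergman D μ) :
    ‖y‖ = (eLpNorm (rep y) 2 (weightedVolume D μ)).toReal := by
  rw [Submodule.coe_norm, Lp.norm_def, eLpNorm_congr_ae (coeFn_ae_eq_rep y)]
  congr 1
  exact eLpNorm_congr_norm_ae (Eventually.of_forall fun z => RCLike.norm_conj _)

/-- Evaluation at a point as a conjugate-linear functional. -/
def evalConj (hD : IsOpen D) (hμ : IsPositiveContinuousWeight D μ) {w : Fin n → ℂ} (hw : w ∈ D) :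
    conjBergman D μ →ₗ⋆[ℂ] ℂ where
  toFun y := rep y w
  map_add' x y := by
    refine rep_eqOn hD hμ (x + y) (g := rep x + rep y)
      ((rep_mem x).1.add (rep_mem y).1).continuousOn ?_ hw
    filter_upwards [Lp.coeFn_add (x : Lp ℂ 2 (weightedVolume D μ)) y, coeFn_ae_eq_rep x,
      coeFn_ae_eq_rep y] with z h1 h2 h3
    rw [Submodule.coe_add, h1, Pi.add_apply, h2, h3, Pi.add_apply, map_add]
  map_smul' t x := by
    refine rep_eqOn hD hμ (t • x) (g := conj t • rep x)
      ((rep_mem x).1.const_smul _).continuousOn ?_ hw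
    filter_upwards [Lp.coeFn_smul t (x : Lp ℂ 2 (weightedVolume D μ)), coeFn_ae_eq_rep x]
      with z h1 h2
    rw [Submodule.coe_smul, h1, Pi.smul_apply, h2, Pi.smul_apply, smul_eq_mul, smul_eq_mul,
      map_mul, Complex.conj_conj]

/-- Using conjugates of Bergman functions makes evaluation at `w` equal to `⟪y, Φ w⟫`, which is
holomorphic in `w`; with the functions themselves the map would be antiholomorphic. Norm holomorphy
of `Φ` follows from this weak form and the locally uniform evaluation bound. -/
theorem exists_representing_map (hD : IsOpen D) (hμ : IsPositiveContinuousWeight D μ) :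
    ∃ Φ : (Fin n → ℂ) → Lp ℂ 2 (weightedVolume D μ), DifferentiableOn ℂ Φ D ∧
      (∀ w ∈ D, Φ w ∈ (conjBergman D μ).topologicalClosure) ∧
      ∀ w ∈ D, ∀ y : conjBergman D μ,
        inner ℂ (y : Lp ℂ 2 (weightedVolume D μ)) (Φ w) = rep y w := by
  have hev : ∀ c ∈ D, ∃ R > 0, ∃ C : ℝ, 0 ≤ C ∧ ball c R ⊆ D ∧ ∀ w ∈ ball c R,
      ∀ y : conjBergman D μ, ‖rep y w‖ ≤ C * ‖y‖ := fun c hc => by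
    obtain ⟨R, hR, C, hC, hRD, h⟩ := exists_eval_bound hD hμ hc
    refine ⟨R, hR, C, hC, hRD, fun w hw y => ?_⟩
    rw [norm_eq_eLpNorm_rep]
    exact h w hw _ (rep_mem y)
  have hex : ∀ w ∈ D, ∃ v ∈ (conjBergman D μ).topologicalClosure, ∀ y : conjBergman D μ,
      inner ℂ (y : Lp ℂ 2 (weightedVolume D μ)) v = rep y w := fun w hw => by
    obtain ⟨R, hR, C, hC, hRD, h⟩ := hev w hw
    exact exists_inner_eq_of_bound _ (evalConj hD hμ hw) C (h w (mem_ball_self hR))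
  choose! Φ hΦmem hΦ using hex
  refine ⟨Φ, differentiableOn_of_inner hD (conjBergman D μ) hΦmem (fun c hc => ?_)
    (fun y hy => ?_), hΦmem, hΦ⟩
  · obtain ⟨R, hR, C, hC, hRD, h⟩ := hev c hc
    refine ⟨R, hR, C, hRD, fun z hz => ?_⟩
    refine norm_le_of_forall_norm_inner_le (hΦmem z (hRD hz)) hC fun y hy => ?_
    have := hΦ z (hRD hz) ⟨y, hy⟩
    rw [this]
    exact h z hz ⟨y, hy⟩
  · exact (rep_mem ⟨y, hy⟩).1.congr fun z hz => hΦ z hz ⟨y, hy⟩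

/-- An `L²` limit has a subsequence converging almost everywhere, while evaluations converge at
every point of `D` by continuity of the inner product. So elements of the closure are still
conjugates of holomorphic functions. -/
theorem ae_eq_conj_inner_of_mem_closure (hD : IsOpen D)
    {Φ : (Fin n → ℂ) → Lp ℂ 2 (weightedVolume D μ)}
    (hΦ : ∀ w ∈ D, ∀ y : conjBergman D μ,
      inner ℂ (y : Lp ℂ 2 (weightedVolume D μ)) (Φ w) = rep y w)
    {x : Lp ℂ 2 (weightedVolume D μ)} (hx : x ∈ (conjBergman D μ).topologicalClosure) :
    x =ᵐ[weightedVolume D μ] fun z => conj (inner ℂ x (Φ z)) := by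
  obtain ⟨y, hyS, hy⟩ := mem_closure_iff_seq_limit.1 hx
  obtain ⟨φ, hφ, hlim⟩ := (tendstoInMeasure_of_tendsto_Lp hy).exists_seq_tendsto_ae
  have hrep : ∀ᵐ z ∂weightedVolume D μ, ∀ k, y k z = conj (rep ⟨y k, hyS k⟩ z) :=
    ae_all_iff.2 fun k => coeFn_ae_eq_rep ⟨y k, hyS k⟩
  filter_upwards [hlim, hrep, ae_weightedVolume_mem hD] with z h1 h2 hz
  have h3 : Tendsto (fun k => conj (inner ℂ (y (φ k)) (Φ z))) atTop
      (𝓝 (conj (inner ℂ x (Φ z)))) :=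
    (Complex.continuous_conj.tendsto _).comp
      ((hy.comp hφ.tendsto_atTop).inner tendsto_const_nhds)
  refine tendsto_nhds_unique h1 (h3.congr fun k => ?_)
  rw [h2, hΦ z hz ⟨y (φ k), hyS (φ k)⟩]

/-- Any two representers of evaluations are conjugate symmetric. -/
theorem IsEvaluationRepresenter.apply_eq_conj {z w : Fin n → ℂ} {k k' : (Fin n → ℂ) → ℂ}
    (hk : IsEvaluationRepresenter D μ w k) (hk' : IsEvaluationRepresenter D μ z k') :
    k z = conj (k' w) := by
  rw [hk'.2 k hk.1, hk.2 k' hk'.1, ← integral_conj]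
  refine integral_congr_ae (Eventually.of_forall fun ζ => ?_)
  simp only [map_mul, Complex.conj_conj, mul_comm]

theorem IsEvaluationRepresenter.isEvaluationRepresenter_kernel {w : Fin n → ℂ}
    {k : (Fin n → ℂ) → ℂ} (hk : IsEvaluationRepresenter D μ w k) :
    IsEvaluationRepresenter D μ w (fun z => kernel D μ z w) := by
  have h : ∃ k, IsEvaluationRepresenter D μ w k := ⟨k, hk⟩
  have : (fun z => kernel D μ z w) = h.choose := funext fun z => dif_pos h
  rw [this]
  exact h.choose_spec

/-- The weighted Bergman kernel is the Gram kernel of a holomorphic map into a Hilbert space. -/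
theorem exists_gram_map (hD : IsBoundedDomain D) (hμ : IsPositiveContinuousWeight D μ) :
    ∃ Φ : (Fin n → ℂ) → Lp ℂ 2 (weightedVolume D μ), DifferentiableOn ℂ Φ D ∧
      (∀ w ∈ D, Φ w ≠ 0) ∧
      (∀ w ∈ D, IsEvaluationRepresenter D μ w (fun z => kernel D μ z w)) ∧
      ∀ z ∈ D, ∀ w ∈ D, kernel D μ z w = inner ℂ (Φ w) (Φ z) := by
  obtain ⟨Φ, hΦd, hΦmem, hΦ⟩ := exists_representing_map hD.isOpen hμ
  have hrep : ∀ w ∈ D, IsEvaluationRepresenter D μ w (fun z => inner ℂ (Φ w) (Φ z)) := by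
    intro w hw
    have hae := ae_eq_conj_inner_of_mem_closure hD.isOpen hΦ (hΦmem w hw)
    refine ⟨⟨differentiableOn_const_inner hΦd _, ?_⟩, fun g hg => ?_⟩
    · refine (memLp_conj (Lp.memLp (Φ w))).ae_eq ?_
      filter_upwards [hae] with z hz
      rw [hz, Complex.conj_conj]
    · have h1 := hΦ w hw (toConjBergman hg)
      rw [rep_toConjBergman hD.isOpen hμ hg hw, L2.inner_def] at h1
      rw [← h1]
      refine integral_congr_ae ?_
      filter_upwards [hae, coeFn_toConjBergman hg] with z h2 h3
      rw [h2, h3, RCLike.inner_apply, Complex.conj_conj, mul_comm]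
  have hker := fun w hw => (hrep w hw).isEvaluationRepresenter_kernel
  refine ⟨Φ, hΦd, fun w hw h0 => ?_, hker, fun z hz w hw => ?_⟩
  -- The constant function `1` is square integrable as the weighted measure is finite, and its value
  -- at `w` is not zero.
  · have := isFiniteMeasure_weightedVolume hD.isBounded hμ
    have h1 : (fun _ => 1) ∈ bergmanSpace D μ := ⟨differentiableOn_const _, memLp_const 1⟩
    have h2 := hΦ w hw (toConjBergman h1)
    rw [rep_toConjBergman hD.isOpen hμ h1 hw, h0, inner_zero_right] at h2
    exact zero_ne_one h2
  · rw [(hker w hw).apply_eq_conj (hrep z hz), inner_conj_symm]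

end Kernel

/-! ### The reproducing formula on the unit disc -/

section DiscKernel

theorem one_sub_mul_conj_ne_zero {w ζ : ℂ} (hw : ‖w‖ < 1) (hζ : ‖ζ‖ ≤ 1) :
    1 - w * conj ζ ≠ 0 := fun h => by
  have h1 : ‖w * conj ζ‖ = 1 := by rw [← sub_eq_zero.1 h]; simp
  rw [norm_mul, RCLike.norm_conj] at h1
  nlinarith [norm_nonneg w, norm_nonneg ζ]

/-- On the circle of radius `ρ` one has `ζ̄ = ρ ^ 2 / ζ`, which turns the average into Cauchy's
formula for the derivative of `ζ * G ζ` at `w * ρ ^ 2`. -/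
theorem circleAverage_mul_kernel {G : ℂ → ℂ} (hG : DifferentiableOn ℂ G (ball 0 1)) {w : ℂ}
    (hw : ‖w‖ < 1) {ρ : ℝ} (h0 : 0 < ρ) (h1 : ρ < 1) :
    Real.circleAverage (fun ζ => G ζ * (1 / (1 - w * conj ζ) ^ 2)) 0 ρ =
      deriv (fun ζ => ζ * G ζ) (w * ρ ^ 2) := by
  have hU : DifferentiableOn ℂ (fun ζ => ζ * G ζ) (ball 0 1) := differentiableOn_id.mul hG
  have hmem : w * (ρ : ℂ) ^ 2 ∈ ball (0 : ℂ) ρ := by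
    rw [mem_ball_zero_iff, norm_mul, norm_pow, Complex.norm_real, Real.norm_of_nonneg h0.le]
    nlinarith [norm_nonneg w, mul_pos h0 h0]
  rw [← Complex.two_pi_I_inv_smul_circleIntegral_sub_sq_inv_smul_of_differentiable isOpen_ball
    (closedBall_subset_ball h1) hU hmem, Real.circleAverage_eq_circleIntegral h0.ne']
  congr 1
  refine circleIntegral.integral_congr h0.le fun ζ hζ => ?_
  rw [mem_sphere_zero_iff_norm] at hζ
  have hζ0 : ζ ≠ 0 := fun h => by rw [h, norm_zero] at hζ; exact h0.ne hζ
  have hconj : conj ζ = (ρ : ℂ) ^ 2 / ζ := by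
    rw [eq_div_iff hζ0, mul_comm, Complex.mul_conj, Complex.normSq_eq_norm_sq, hζ]
    push_cast; ring
  have hne := one_sub_mul_conj_ne_zero hw (hζ.le.trans h1.le)
  have hne2 : ζ - w * (ρ : ℂ) ^ 2 ≠ 0 := fun h => by
    rw [sub_eq_zero.1 h] at hζ
    rw [mem_ball_zero_iff, hζ] at hmem
    exact lt_irrefl _ hmem
  rw [hconj] at hne
  simp only [hconj, smul_eq_mul, sub_zero]
  field_simp

/-- In polar coordinates the circle averages integrate exactly: `2πρ` times the derivative of `ζ * G
ζ` at `w * ρ ^ 2` is the `ρ`-derivative of `π ρ ^ 2 G (w ρ ^ 2)`. -/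
theorem setIntegral_ball_mul_kernel {G : ℂ → ℂ} (hG : DifferentiableOn ℂ G (ball 0 1)) {w : ℂ}
    (hw : ‖w‖ < 1) {r : ℝ} (h0 : 0 < r) (h1 : r < 1) :
    ∫ ζ in ball 0 r, G ζ * (1 / (1 - w * conj ζ) ^ 2) = Real.pi * r ^ 2 * G (w * r ^ 2) := by
  set F : ℂ → ℂ := fun ζ => G ζ * (1 / (1 - w * conj ζ) ^ 2) with hF
  have hFc : ContinuousOn F (closedBall 0 r) := by
    refine (hG.continuousOn.mono (closedBall_subset_ball h1)).mul
      (continuousOn_const.div (by fun_prop) fun ζ hζ => pow_ne_zero _ ?_)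
    exact one_sub_mul_conj_ne_zero hw ((mem_closedBall_zero_iff.1 hζ).trans h1.le)
  have hsymm : ∀ ρ θ : ℝ, Complex.polarCoord.symm (ρ, θ) = circleMap 0 ρ θ := fun ρ θ => by
    rw [Complex.polarCoord_symm_apply, circleMap, zero_add, Complex.exp_mul_I,
      Complex.ofReal_cos, Complex.ofReal_sin]
  have hcm : Continuous fun p : ℝ × ℝ => circleMap 0 p.1 p.2 := by
    simp only [circleMap]
    fun_prop
  have hcont : ContinuousOn (fun p : ℝ × ℝ => p.1 • F (circleMap 0 p.1 p.2))
      (Icc 0 r ×ˢ Icc (-Real.pi) Real.pi) := by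
    refine continuousOn_fst.smul (hFc.comp hcm.continuousOn fun p hp => ?_)
    rw [mem_closedBall_zero_iff, norm_circleMap_zero, abs_of_nonneg hp.1.1]
    exact hp.1.2
  have hint : IntegrableOn (fun p : ℝ × ℝ => p.1 • F (circleMap 0 p.1 p.2))
      (Ioo 0 r ×ˢ Ioo (-Real.pi) Real.pi) (volume.prod volume) :=
    (hcont.integrableOn_compact (isCompact_Icc.prod isCompact_Icc)).mono_set
      (prod_mono Ioo_subset_Icc_self Ioo_subset_Icc_self)
  have hpolar : ∫ ζ in ball 0 r, F ζ =
      ∫ p in Ioo 0 r ×ˢ Ioo (-Real.pi) Real.pi, p.1 • F (circleMap 0 p.1 p.2) := by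
    rw [← integral_indicator measurableSet_ball, ← Complex.integral_comp_polarCoord_symm,
      ← integral_indicator (measurableSet_Ioo.prod measurableSet_Ioo),
      ← integral_indicator polarCoord.open_target.measurableSet]
    congr 1
    ext ⟨ρ, θ⟩
    simp only [indicator, hsymm, polarCoord_target, mem_prod, mem_Ioi, mem_Ioo,
      mem_ball_zero_iff, norm_circleMap_zero]
    by_cases hρ : 0 < ρ
    · rw [abs_of_pos hρ]
      by_cases hρr : ρ < r <;> by_cases hθ : -Real.pi < θ ∧ θ < Real.pi <;> simp [hρ, hρr, hθ]
    · simp [hρ]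
  have hinner : ∀ ρ ∈ Ioo 0 r, ∫ θ in Ioo (-Real.pi) Real.pi, ρ • F (circleMap 0 ρ θ) =
      (2 * Real.pi * ρ) * deriv (fun ζ => ζ * G ζ) (w * ρ ^ 2) := by
    intro ρ hρ
    rw [← circleAverage_mul_kernel hG hw hρ.1 (hρ.2.trans h1), Real.circleAverage_def,
      integral_smul, ← integral_Ioc_eq_integral_Ioo,
      ← intervalIntegral.integral_of_le (by linarith [Real.pi_pos])]
    have hper : Function.Periodic (fun θ => F (circleMap 0 ρ θ)) (2 * Real.pi) := fun θ => by
      simp only [periodic_circleMap 0 ρ θ]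
    have := hper.intervalIntegral_add_eq (-Real.pi) 0
    rw [show -Real.pi + 2 * Real.pi = Real.pi by ring, zero_add] at this
    rw [this, Complex.real_smul, Complex.real_smul]
    have hpi : (Real.pi : ℂ) ≠ 0 := by exact_mod_cast Real.pi_ne_zero
    simp only [hF]
    push_cast
    field_simp
  rw [hpolar]
  erw [setIntegral_prod _ hint]
  rw [setIntegral_congr_fun measurableSet_Ioo hinner, ← integral_Ioc_eq_integral_Ioo,
    ← intervalIntegral.integral_of_le h0.le]
  have hmem : ∀ ρ ∈ uIcc 0 r, w * (ρ : ℂ) ^ 2 ∈ ball (0 : ℂ) 1 := fun ρ hρ => by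
    rw [uIcc_of_le h0.le] at hρ
    rw [mem_ball_zero_iff, norm_mul, norm_pow, Complex.norm_real, Real.norm_of_nonneg hρ.1]
    have : ρ ^ 2 ≤ 1 := by nlinarith [hρ.1, hρ.2]
    nlinarith [norm_nonneg w, sq_nonneg ρ]
  have hU : DifferentiableOn ℂ (fun ζ => ζ * G ζ) (ball 0 1) := differentiableOn_id.mul hG
  have hftc := intervalIntegral.integral_eq_sub_of_hasDerivAt (a := 0) (b := r)
    (f := fun ρ : ℝ => (Real.pi : ℂ) * (ρ : ℂ) ^ 2 * G (w * (ρ : ℂ) ^ 2))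
    (f' := fun ρ : ℝ => (2 * Real.pi * ρ : ℂ) * deriv (fun ζ => ζ * G ζ) (w * (ρ : ℂ) ^ 2))
    (fun ρ hρ => ?_) ?_
  · rw [hftc]; simp
  · have hGd := (hG.differentiableAt (isOpen_ball.mem_nhds (hmem ρ hρ))).hasDerivAt
    have hd : deriv (fun ζ => ζ * G ζ) (w * (ρ : ℂ) ^ 2) =
        1 * G (w * (ρ : ℂ) ^ 2) + (w * (ρ : ℂ) ^ 2) * deriv G (w * (ρ : ℂ) ^ 2) :=
      ((hasDerivAt_id _).mul hGd).deriv
    have hsq : HasDerivAt (fun ρ : ℝ => (ρ : ℂ) ^ 2) (2 * ρ) ρ := by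
      simpa using (hasDerivAt_pow 2 (ρ : ℂ)).comp_ofReal
    have hcomp : HasDerivAt (fun ρ : ℝ => G (w * (ρ : ℂ) ^ 2))
        (deriv G (w * (ρ : ℂ) ^ 2) * (w * (2 * ρ))) ρ :=
      HasDerivAt.comp ρ (h₂ := G) (h := fun ρ : ℝ => w * (ρ : ℂ) ^ 2) hGd (hsq.const_mul w)
    refine ((hsq.const_mul (Real.pi : ℂ)).mul hcomp).congr_deriv ?_
    rw [hd]; ring
  · refine ContinuousOn.intervalIntegrable ?_
    refine ContinuousOn.mul (by fun_prop) ?_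
    exact ((hU.deriv isOpen_ball).continuousOn).comp (by fun_prop) hmem

theorem setIntegral_unit_ball_mul_kernel {G : ℂ → ℂ} (hG : DifferentiableOn ℂ G (ball 0 1)) {w : ℂ}
    (hw : ‖w‖ < 1) (hint : IntegrableOn (fun ζ => G ζ * (1 / (1 - w * conj ζ) ^ 2)) (ball 0 1)) :
    ∫ ζ in ball 0 1, G ζ * (1 / (1 - w * conj ζ) ^ 2) = Real.pi * G w := by
  -- Radii increasing to `1`; the `+ 2` keeps `r 0` positive.
  set r : ℕ → ℝ := fun k => 1 - 1 / ((k : ℝ) + 2) with hr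
  have hr0 : ∀ k, 0 < r k := fun k => by
    have : 1 / ((k : ℝ) + 2) < 1 := by
      rw [div_lt_one (by positivity)]; linarith [(Nat.cast_nonneg k : (0 : ℝ) ≤ k)]
    simp only [hr]; linarith
  have hr1 : ∀ k, r k < 1 := fun k => by
    have : 0 < 1 / ((k : ℝ) + 2) := by positivity
    simp only [hr]; linarith
  have hrm : Monotone r := fun j k hjk => by
    have : (j : ℝ) ≤ k := by exact_mod_cast hjk
    simp only [hr]
    gcongr
  have hrlim : Tendsto r atTop (𝓝 1) := by
    have h1 : Tendsto (fun k : ℕ => (k : ℝ) + 2) atTop atTop :=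
      tendsto_atTop_add_const_right _ _ tendsto_natCast_atTop_atTop
    change Tendsto (fun k : ℕ => 1 - 1 / ((k : ℝ) + 2)) atTop (𝓝 1)
    simpa using (h1.inv_tendsto_atTop).const_sub 1
  have hunion : ⋃ k, ball (0 : ℂ) (r k) = ball 0 1 := by
    refine Subset.antisymm (iUnion_subset fun k => ball_subset_ball (hr1 k).le) fun z hz => ?_
    rw [mem_ball_zero_iff] at hz
    obtain ⟨k, hk⟩ := (hrlim.eventually_const_lt hz).exists
    exact mem_iUnion.2 ⟨k, mem_ball_zero_iff.2 hk⟩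
  have h1 := tendsto_setIntegral_of_monotone (μ := volume)
    (s := fun k => ball (0 : ℂ) (r k)) (fun k => measurableSet_ball)
    (fun j k hjk => ball_subset_ball (hrm hjk)) (by rwa [hunion])
  rw [hunion] at h1
  refine tendsto_nhds_unique h1 ?_
  have h2 : Tendsto (fun k => (Real.pi : ℂ) * (r k : ℂ) ^ 2 * G (w * (r k : ℂ) ^ 2)) atTop
      (𝓝 ((Real.pi : ℂ) * (1 : ℂ) ^ 2 * G w)) := by
    have h3 : Tendsto (fun k => (r k : ℂ)) atTop (𝓝 1) := by
      have := (Complex.continuous_ofReal.tendsto 1).comp hrlim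
      rwa [Complex.ofReal_one] at this
    have h4 : Tendsto (fun k => w * (r k : ℂ) ^ 2) atTop (𝓝 w) := by
      simpa using (h3.pow 2).const_mul w
    have hGc : ContinuousAt G w :=
      hG.continuousOn.continuousAt (isOpen_ball.mem_nhds (mem_ball_zero_iff.2 hw))
    exact ((h3.pow 2).const_mul _).mul (hGc.tendsto.comp h4)
  rw [one_pow, mul_one] at h2
  exact h2.congr fun k => (setIntegral_ball_mul_kernel hG hw (hr0 k) (hr1 k)).symm

end DiscKernel

/-! ### The kernel identity for isometries -/

section Isometry

variable {n m : ℕ} {D₁ : Set (Fin n → ℂ)} {D₂ : Set (Fin m → ℂ)}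
  {μ₁ : (Fin n → ℂ) → ℝ} {μ₂ : (Fin m → ℂ) → ℝ} {f : (Fin n → ℂ) → (Fin m → ℂ)}

theorem kernel_conj_symm (hD : IsBoundedDomain D₁) (hμ : IsPositiveContinuousWeight D₁ μ₁)
    {z w : Fin n → ℂ} (hz : z ∈ D₁) (hw : w ∈ D₁) :
    conj (kernel D₁ μ₁ z w) = kernel D₁ μ₁ w z := by
  obtain ⟨Φ, -, -, -, hΦ⟩ := exists_gram_map hD hμ
  rw [hΦ z hz w hw, hΦ w hw z hz, inner_conj_symm]

theorem kernel_mem_bergmanSpace (hD : IsBoundedDomain D₁) (hμ : IsPositiveContinuousWeight D₁ μ₁)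
    {w : Fin n → ℂ} (hw : w ∈ D₁) : (fun z => kernel D₁ μ₁ z w) ∈ bergmanSpace D₁ μ₁ := by
  obtain ⟨Φ, -, -, hker, -⟩ := exists_gram_map hD hμ
  exact (hker w hw).1

theorem exists_kernel_self_eq (hD : IsBoundedDomain D₁) (hμ : IsPositiveContinuousWeight D₁ μ₁)
    {w : Fin n → ℂ} (hw : w ∈ D₁) : ∃ r : ℝ, 0 < r ∧ kernel D₁ μ₁ w w = r := by
  obtain ⟨Φ, -, h0, -, hΦ⟩ := exists_gram_map hD hμ
  refine ⟨‖Φ w‖ ^ 2, pow_pos (norm_pos_iff.2 (h0 w hw)) 2, ?_⟩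
  rw [hΦ w hw w hw, inner_self_eq_norm_sq_to_K]
  push_cast; rfl

theorem kernel_self_ne_zero (hD : IsBoundedDomain D₁) (hμ : IsPositiveContinuousWeight D₁ μ₁)
    {w : Fin n → ℂ} (hw : w ∈ D₁) : kernel D₁ μ₁ w w ≠ 0 := by
  obtain ⟨r, hr, h⟩ := exists_kernel_self_eq hD hμ hw
  rw [h]; exact_mod_cast hr.ne'

theorem continuousOn_kernel_self (hD : IsBoundedDomain D₁) (hμ : IsPositiveContinuousWeight D₁ μ₁) :
    ContinuousOn (fun z => kernel D₁ μ₁ z z) D₁ := by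
  obtain ⟨Φ, hΦd, -, -, hΦ⟩ := exists_gram_map hD hμ
  exact (hΦd.continuousOn.inner hΦd.continuousOn).congr fun z hz => hΦ z hz z hz

/-- The kernels of isometric domains agree up to normalization at a point. -/
theorem IsHolomorphicIsometry.kernel_identity (hD₁ : IsBoundedDomain D₁) (hD₂ : IsBoundedDomain D₂)
    (hμ₁ : IsPositiveContinuousWeight D₁ μ₁) (hμ₂ : IsPositiveContinuousWeight D₂ μ₂)
    (hf : IsHolomorphicIsometry D₁ μ₁ D₂ μ₂ f) {p z w : Fin n → ℂ} (hp : p ∈ D₁) (hz : z ∈ D₁)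
    (hw : w ∈ D₁) :
    kernel D₂ μ₂ (f z) (f w) * kernel D₁ μ₁ z p * kernel D₁ μ₁ p w * kernel D₂ μ₂ (f p) (f p) =
      kernel D₁ μ₁ z w * kernel D₂ μ₂ (f z) (f p) * kernel D₂ μ₂ (f p) (f w) *
        kernel D₁ μ₁ p p := by
  obtain ⟨Φ₁, hd₁, h0₁, -, hΦ₁⟩ := exists_gram_map hD₁ hμ₁
  obtain ⟨Φ₂, hd₂, h0₂, -, hΦ₂⟩ := exists_gram_map hD₂ hμ₂
  have hm := hf.mapsTo
  -- The isometry condition with denominators cleared: by the chain rule the pulled back metric is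
  -- the Levi form attached to `Φ₂ ∘ f`.
  have hgram : ∀ z ∈ D₁, ∀ X, gramForm (fun z => Φ₂ (f z)) z z X X * inner ℂ (Φ₁ z) (Φ₁ z) ^ 2 =
      gramForm Φ₁ z z X X * inner ℂ (Φ₂ (f z)) (Φ₂ (f z)) ^ 2 := by
    intro z hz X
    have hiso := hf.isometry z hz X
    rw [metricNormSq_eq_gramForm hD₂.isOpen hd₂ h0₂ (fun w hw => hΦ₂ w hw w hw) (hm hz),
      metricNormSq_eq_gramForm hD₁.isOpen hd₁ h0₁ (fun w hw => hΦ₁ w hw w hw) hz,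
      div_eq_div_iff (pow_ne_zero _ (inner_self_ne_zero.2 (h0₂ _ (hm hz))))
        (pow_ne_zero _ (inner_self_ne_zero.2 (h0₁ z hz)))] at hiso
    have hchain : fderiv ℂ (fun z => Φ₂ (f z)) z X =
        fderiv ℂ Φ₂ (f z) (fderiv ℂ f z X) := by
      rw [fderiv_fun_comp z (hd₂.differentiableAt (hD₂.isOpen.mem_nhds (hm hz)))
        (hf.holomorphic.differentiableAt (hD₁.isOpen.mem_nhds hz))]
      rfl
    rw [← hiso]
    simp only [gramForm, hchain]
  have := inner_mul_eq_of_gramForm_eq hD₁.isOpen hD₁.isConnected.isPreconnected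
    (hd₂.comp hf.holomorphic hm) hd₁ hp (h0₂ _ (hm hp)) (h0₁ p hp) hgram hz hw
  rw [hΦ₁ z hz p hp, hΦ₁ p hp w hw, hΦ₁ z hz w hw, hΦ₁ p hp p hp, hΦ₂ _ (hm hz) _ (hm hw),
    hΦ₂ _ (hm hp) _ (hm hp), hΦ₂ _ (hm hz) _ (hm hp), hΦ₂ _ (hm hp) _ (hm hw)]
  exact this

/-- The kernel identity already splits into a factor in `z` and a conjugate factor in `w`. The
constant `c`, with `c ^ 2 = K₁(p, p) / K₂(f p, f p)`, absorbs the two diagonal values at `p`. -/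
theorem IsHolomorphicIsometry.exists_kernel_factors (hD₁ : IsBoundedDomain D₁)
    (hD₂ : IsBoundedDomain D₂)
    (hμ₁ : IsPositiveContinuousWeight D₁ μ₁) (hμ₂ : IsPositiveContinuousWeight D₂ μ₂)
    (hf : IsHolomorphicIsometry D₁ μ₁ D₂ μ₂ f) :
    ∃ s₀ ∈ bergmanSpace D₁ μ₁, ∃ r₀ ∈ bergmanSpace D₂ μ₂,
      (∃ z ∈ D₁, s₀ z ≠ 0) ∧ (∃ z ∈ D₁, r₀ (f z) ≠ 0) ∧
      ∀ z ∈ D₁, ∀ w ∈ D₁, s₀ z * conj (s₀ w) * kernel D₂ μ₂ (f z) (f w) =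
        r₀ (f z) * conj (r₀ (f w)) * kernel D₁ μ₁ z w := by
  obtain ⟨p, hp⟩ := hD₁.isConnected.nonempty
  have hfp := hf.mapsTo hp
  obtain ⟨a, ha, hKa⟩ := exists_kernel_self_eq hD₁ hμ₁ hp
  obtain ⟨b, hb, hKb⟩ := exists_kernel_self_eq hD₂ hμ₂ hfp
  set c : ℂ := ((√(a / b) : ℝ) : ℂ) with hc
  have hcc : c * conj c * b = a := by
    rw [hc, Complex.conj_ofReal, ← Complex.ofReal_mul, Real.mul_self_sqrt (by positivity),
      ← Complex.ofReal_mul, div_mul_cancel₀ _ hb.ne']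
  have hc0 : c ≠ 0 := Complex.ofReal_ne_zero.2 (Real.sqrt_pos.2 (by positivity)).ne'
  have hr := kernel_mem_bergmanSpace hD₂ hμ₂ hfp
  refine ⟨fun z => kernel D₁ μ₁ z p, kernel_mem_bergmanSpace hD₁ hμ₁ hp,
    c • fun ζ => kernel D₂ μ₂ ζ (f p), ⟨hr.1.const_smul c, hr.2.const_smul c⟩,
    ⟨p, hp, kernel_self_ne_zero hD₁ hμ₁ hp⟩,
    ⟨p, hp, mul_ne_zero hc0 (kernel_self_ne_zero hD₂ hμ₂ hfp)⟩, fun z hz w hw => ?_⟩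
  have hid := hf.kernel_identity hD₁ hD₂ hμ₁ hμ₂ hp hz hw
  simp only [Pi.smul_apply, smul_eq_mul, map_mul, kernel_conj_symm hD₁ hμ₁ hw hp,
    kernel_conj_symm hD₂ hμ₂ (hf.mapsTo hw) hfp]
  rw [hKa, hKb, ← hcc] at hid
  have hb0 : (b : ℂ) ≠ 0 := Complex.ofReal_ne_zero.2 hb.ne'
  apply mul_right_cancel₀ hb0
  linear_combination hid

end Isometry

/-! ### Inverses of injective holomorphic functions -/

section OneVariable

/-- Open mapping makes the inverse continuous, and it is differentiable where the derivative of `F`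
is not zero. Critical points are isolated, so the remaining points are removable singularities; that
there are no critical points is not needed. -/
theorem differentiableOn_invFunOn {F : ℂ → ℂ} {U : Set ℂ} (hU : IsOpen U)
    (hF : DifferentiableOn ℂ F U) (hinj : InjOn F U) :
    IsOpen (F '' U) ∧ DifferentiableOn ℂ (Function.invFunOn F U) (F '' U) := by
  have han : AnalyticOnNhd ℂ F U := hF.analyticOnNhd hU
  have hnc : ∀ z ∈ U, ¬ ∀ᶠ ζ in 𝓝 z, F ζ = F z := fun z hz h => by
    have h1 : ∀ᶠ ζ in 𝓝[≠] z, ζ = z :=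
      ((h.and (hU.mem_nhds hz)).filter_mono nhdsWithin_le_nhds).mono
        fun ζ hζ => hinj hζ.2 hz hζ.1
    obtain ⟨ζ, hζ, hne⟩ := (h1.and self_mem_nhdsWithin).exists
    exact hne hζ
  have hmap : ∀ z ∈ U, 𝓝 (F z) ≤ map F (𝓝 z) := fun z hz =>
    (han z hz).eventually_constant_or_nhds_le_map_nhds.resolve_left (hnc z hz)
  have hopen : IsOpen (F '' U) := isOpen_iff_mem_nhds.2 <| by
    rintro _ ⟨z, hz, rfl⟩
    exact hmap z hz (image_mem_map (hU.mem_nhds hz))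
  set G := Function.invFunOn F U
  have hGF : ∀ z ∈ U, G (F z) = z := fun z hz => hinj.leftInvOn_invFunOn hz
  have hcont : ∀ z ∈ U, ContinuousAt G (F z) := fun z hz => by
    rw [ContinuousAt, hGF z hz]
    refine (Filter.map_mono (hmap z hz)).trans ?_
    rw [Filter.map_map]
    refine Filter.Tendsto.congr' (f₁ := id) ?_ tendsto_id
    filter_upwards [hU.mem_nhds hz] with ζ hζ using (hGF ζ hζ).symm
  have hreg : ∀ z ∈ U, deriv F z ≠ 0 → DifferentiableAt ℂ G (F z) := fun z hz h0 => by
    refine (HasDerivAt.of_local_left_inverse (f := F) (f' := deriv F z) (hcont z hz) ?_ h0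
      ?_).differentiableAt
    · rw [hGF z hz]; exact (hF.differentiableAt (hU.mem_nhds hz)).hasDerivAt
    · filter_upwards [hopen.mem_nhds (mem_image_of_mem F hz)] with y hy
      exact Function.invFunOn_eq hy
  refine ⟨hopen, ?_⟩
  rintro _ ⟨z, hz, rfl⟩
  refine DifferentiableAt.differentiableWithinAt
    (Complex.analyticAt_of_differentiable_on_punctured_nhds_of_continuousAt ?_
      (hcont z hz)).differentiableAt
  have hne : ∀ᶠ ζ in 𝓝[≠] z, deriv F ζ ≠ 0 := by
    refine ((han.deriv z hz).eventually_eq_zero_or_eventually_ne_zero).resolve_left fun h => ?_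
    obtain ⟨ε, hε, hball⟩ := Metric.eventually_nhds_iff_ball.1 (h.and (hU.mem_nhds hz))
    refine hnc z hz (Filter.mem_of_superset (ball_mem_nhds z hε) fun ζ hζ => ?_)
    refine (convex_ball z ε).is_const_of_fderivWithin_eq_zero (𝕜 := ℂ)
      (fun y hy => (hF.differentiableAt (hU.mem_nhds (hball y hy).2)).differentiableWithinAt)
      (fun y hy => ?_) hζ (mem_ball_self hε)
    rw [fderivWithin_of_isOpen isOpen_ball hy]
    ext
    simpa using (hball y hy).1
  have htend : Tendsto G (𝓝[≠] (F z)) (𝓝[≠] z) := by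
    refine tendsto_nhdsWithin_iff.2 ⟨?_, ?_⟩
    · have := (hcont z hz).tendsto
      rw [hGF z hz] at this
      exact this.mono_left nhdsWithin_le_nhds
    · filter_upwards [nhdsWithin_le_nhds (hopen.mem_nhds (mem_image_of_mem F hz)),
        self_mem_nhdsWithin] with y hy hyne hGy
      refine hyne ?_
      rw [mem_singleton_iff] at hGy ⊢
      rw [← hGy]
      exact (Function.invFunOn_eq hy).symm
  filter_upwards [htend.eventually hne,
    nhdsWithin_le_nhds (hopen.mem_nhds (mem_image_of_mem F hz))] with y hy hyU
  have h1 := hreg (G y) (Function.invFunOn_mem hyU) hy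
  rwa [Function.invFunOn_eq hyU] at h1

end OneVariable

/-! ### The unweighted kernel of the disc -/

section Disc

theorem disc_eq_preimage :
    disc = (ContinuousLinearEquiv.funUnique (Fin 1) ℂ ℂ) ⁻¹' ball 0 1 := by
  ext z
  simp [disc]

theorem disc_eq_ball : disc = ball 0 1 := by
  ext z
  rw [mem_ball_zero_iff, pi_norm_lt_iff one_pos]
  simp [disc]

theorem isBoundedDomain_disc : IsBoundedDomain disc := by
  rw [disc_eq_ball]
  exact ⟨isOpen_ball, ⟨⟨0, mem_ball_self one_pos⟩, (convex_ball _ _).isPreconnected⟩,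
    isBounded_ball⟩

theorem isPositiveContinuousWeight_of_eq_one {n : ℕ} {D : Set (Fin n → ℂ)} {μ : (Fin n → ℂ) → ℝ}
    (h : ∀ z ∈ closure D, μ z = 1) : IsPositiveContinuousWeight D μ :=
  ⟨continuousOn_const.congr h, fun z hz => by rw [h z hz]; exact one_pos⟩

theorem weightedVolume_of_eq_one {n : ℕ} {D : Set (Fin n → ℂ)} {μ : (Fin n → ℂ) → ℝ}
    (hD : IsOpen D) (h : ∀ z ∈ closure D, μ z = 1) :
    weightedVolume D μ = volume.restrict D := by
  have : (fun z => ENNReal.ofReal (μ z)) =ᵐ[volume.restrict D] 1 :=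
    (ae_restrict_iff' hD.measurableSet).2 (Eventually.of_forall fun z hz => by
      simp [h z (subset_closure hz)])
  rw [weightedVolume, withDensity_congr_ae this, withDensity_one]

variable {μ : (Fin 1 → ℂ) → ℝ}

theorem isEvaluationRepresenter_disc (h : ∀ z ∈ closure disc, μ z = 1) {w : Fin 1 → ℂ}
    (hw : w ∈ disc) :
    IsEvaluationRepresenter disc μ w (fun z => 1 / (Real.pi * (1 - z 0 * conj (w 0)) ^ 2)) := by
  have hw' : ‖w 0‖ < 1 := hw
  have hD := isBoundedDomain_disc
  have hν := weightedVolume_of_eq_one hD.isOpen h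
  have hfin := isFiniteMeasure_weightedVolume hD.isBounded (isPositiveContinuousWeight_of_eq_one h)
  have hpi : (Real.pi : ℂ) ≠ 0 := by exact_mod_cast Real.pi_ne_zero
  have hne : ∀ z ∈ disc, 1 - z 0 * conj (w 0) ≠ 0 := fun z hz =>
    one_sub_mul_conj_ne_zero hz hw'.le
  have hdiff : DifferentiableOn ℂ
      (fun z : Fin 1 → ℂ => 1 / (Real.pi * (1 - z 0 * conj (w 0)) ^ 2)) disc := by
    simp only [one_div]
    exact DifferentiableOn.inv (by fun_prop) fun z hz =>
      mul_ne_zero hpi (pow_ne_zero _ (hne z hz))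
  have hmem : MemLp (fun z : Fin 1 → ℂ => 1 / (Real.pi * (1 - z 0 * conj (w 0)) ^ 2)) 2
      (weightedVolume disc μ) := by
    refine MemLp.of_bound ?_ (1 / (Real.pi * (1 - ‖w 0‖) ^ 2)) ?_
    · rw [hν]; exact hdiff.continuousOn.aestronglyMeasurable hD.isOpen.measurableSet
    · filter_upwards [ae_weightedVolume_mem hD.isOpen] with z hz
      have hz' : ‖z 0‖ < 1 := hz
      rw [norm_div, norm_mul, norm_pow, norm_one, Complex.norm_real,
        Real.norm_of_nonneg Real.pi_pos.le]
      have h1 : 1 - ‖w 0‖ ≤ ‖1 - z 0 * conj (w 0)‖ := by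
        have h2 := norm_sub_norm_le (1 : ℂ) (z 0 * conj (w 0))
        rw [norm_one, norm_mul, RCLike.norm_conj] at h2
        nlinarith [norm_nonneg (w 0), norm_nonneg (z 0)]
      have h3 : 0 < 1 - ‖w 0‖ := by linarith
      have := Real.pi_pos
      gcongr
  refine ⟨⟨hdiff, hmem⟩, fun g hg => ?_⟩
  have hmp := (volume_preserving_funUnique (Fin 1) ℂ).symm
  have hemb := (MeasurableEquiv.funUnique (Fin 1) ℂ).symm.measurableEmbedding
  have hpre : (MeasurableEquiv.funUnique (Fin 1) ℂ).symm ⁻¹' disc = ball 0 1 := by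
    ext t
    rw [mem_ball_zero_iff]
    rfl
  have hconj : ∀ z : Fin 1 → ℂ, conj (1 / (Real.pi * (1 - z 0 * conj (w 0)) ^ 2)) =
      (Real.pi : ℂ)⁻¹ * (1 / (1 - w 0 * conj (z 0)) ^ 2) := fun z => by
    simp only [map_div₀, map_one, map_mul, map_pow, map_sub, Complex.conj_ofReal,
      Complex.conj_conj]
    rw [mul_comm (conj (z 0))]
    field_simp
  have hint : IntegrableOn (fun ζ : Fin 1 → ℂ =>
      g ζ * (1 / (1 - w 0 * conj (ζ 0)) ^ 2)) disc := by
    have h1 : Integrable (fun ζ : Fin 1 → ℂ => g ζ *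
        conj (1 / (Real.pi * (1 - ζ 0 * conj (w 0)) ^ 2))) (weightedVolume disc μ) :=
      hg.2.integrable_mul (memLp_conj hmem)
    rw [hν] at h1
    refine (h1.const_mul (Real.pi : ℂ)).congr (Eventually.of_forall fun ζ => ?_)
    simp only [hconj]
    field_simp
  have hG : DifferentiableOn ℂ (fun t : ℂ => g fun _ => t) (ball 0 1) :=
    hg.1.comp (f := fun t : ℂ => fun _ : Fin 1 => t) (by fun_prop) fun t ht => by
      simpa [disc] using ht
  have hint' := (hmp.integrableOn_comp_preimage hemb).2 hint
  rw [hpre] at hint'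
  have hval := setIntegral_unit_ball_mul_kernel hG hw' hint'
  have htrans := hmp.setIntegral_preimage_emb hemb
    (fun ζ : Fin 1 → ℂ => g ζ * (1 / (1 - w 0 * conj (ζ 0)) ^ 2)) disc
  rw [hpre] at htrans
  have hww : (fun _ => w 0) = w := funext fun i => by rw [Subsingleton.elim i 0]
  simp only [hconj]
  rw [hν]
  calc g w = (Real.pi : ℂ)⁻¹ * (Real.pi * g fun _ => w 0) := by
        rw [hww]; field_simp
    _ = (Real.pi : ℂ)⁻¹ * ∫ ζ in disc, g ζ * (1 / (1 - w 0 * conj (ζ 0)) ^ 2) := by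
        rw [← hval]; exact congrArg ((Real.pi : ℂ)⁻¹ * ·) htrans
    _ = _ := by
        rw [← integral_const_mul]
        refine integral_congr_ae (Eventually.of_forall fun ζ => ?_)
        simp only
        ring

theorem kernel_disc (h : ∀ z ∈ closure disc, μ z = 1) {z w : Fin 1 → ℂ} (hz : z ∈ disc)
    (hw : w ∈ disc) :
    kernel disc μ z w = 1 / (Real.pi * (1 - z 0 * conj (w 0)) ^ 2) := by
  rw [(isEvaluationRepresenter_disc h hw).isEvaluationRepresenter_kernel.apply_eq_conj
    (isEvaluationRepresenter_disc h hz)]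
  simp [mul_comm]

end Disc

/-! ### Isometries of the disc are automorphisms -/

section DiscIsometry

variable {μ₁ μ₂ : (Fin 1 → ℂ) → ℝ} {f : (Fin 1 → ℂ) → (Fin 1 → ℂ)}

theorem injOn_of_isometry_disc (h₁ : ∀ z ∈ closure disc, μ₁ z = 1)
    (hμ₂ : IsPositiveContinuousWeight disc μ₂) (hf : IsHolomorphicIsometry disc μ₁ disc μ₂ f) :
    InjOn f disc := by
  intro z hz z' hz' hff
  have hD := isBoundedDomain_disc
  have hμ₁ := isPositiveContinuousWeight_of_eq_one h₁
  -- The kernel identity with base point `z`, evaluated at `z'` and `w`. Since `f z = f z'`, the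
  -- `K₂` factors cancel where `K₂(f w, f z)` is not zero, in particular near `w = z`; the identity
  -- theorem then removes this restriction.
  have hloc : ∀ᶠ w in 𝓝 z, conj (kernel disc μ₁ z' z) * kernel disc μ₁ w z -
      conj (kernel disc μ₁ z z) * kernel disc μ₁ w z' = 0 := by
    have hcont : ContinuousAt (fun w => kernel disc μ₂ (f w) (f z)) z :=
      ((kernel_mem_bergmanSpace hD hμ₂ (hf.mapsTo hz)).1.continuousOn.comp
        hf.holomorphic.continuousOn hf.mapsTo).continuousAt (hD.isOpen.mem_nhds hz)
    filter_upwards [hcont.eventually_ne (kernel_self_ne_zero hD hμ₂ (hf.mapsTo hz)),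
      hD.isOpen.mem_nhds hz] with w hw0 hw
    have hid := congrArg conj (hf.kernel_identity hD hD hμ₁ hμ₂ hz hz' hw)
    rw [← hff] at hid
    simp only [map_mul, kernel_conj_symm hD hμ₁ hz hw, kernel_conj_symm hD hμ₁ hz' hw,
      kernel_conj_symm hD hμ₂ (hf.mapsTo hz) (hf.mapsTo hw),
      kernel_conj_symm hD hμ₂ (hf.mapsTo hz) (hf.mapsTo hz)] at hid
    apply mul_left_cancel₀ (mul_ne_zero hw0 (kernel_self_ne_zero hD hμ₂ (hf.mapsTo hz)))
    linear_combination hid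
  have hall : ∀ w ∈ disc, conj (kernel disc μ₁ z' z) * kernel disc μ₁ w z -
      conj (kernel disc μ₁ z z) * kernel disc μ₁ w z' = 0 := fun w hw => eqOn_zero_of_eventuallyEq_zero hD.isOpen hD.isConnected.isPreconnected
    (((kernel_mem_bergmanSpace hD hμ₁ hz).1.const_mul _).sub
      ((kernel_mem_bergmanSpace hD hμ₁ hz').1.const_mul _)) hz hloc hw
  have hpi : (Real.pi : ℂ) ≠ 0 := by exact_mod_cast Real.pi_ne_zero
  have h0 : (0 : Fin 1 → ℂ) ∈ disc := by simp [disc]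
  have h2 : (fun _ => 1 / 2 : Fin 1 → ℂ) ∈ disc := by
    simp only [disc, mem_ofPred_eq]; norm_num
  -- At `w = 0` the kernel is the constant `1 / π`, so the proportionality factor is `1`; the point
  -- `w = 1 / 2` then separates `z` from `z'`.
  have e0 : conj (kernel disc μ₁ z' z) = conj (kernel disc μ₁ z z) := by
    have := hall 0 h0
    simp only [kernel_disc h₁ h0 hz, kernel_disc h₁ h0 hz'] at this
    simpa [sub_eq_zero, hpi] using this
  have e2 := hall _ h2
  rw [e0, ← mul_sub] at e2
  have hne : conj (kernel disc μ₁ z z) ≠ 0 := by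
    rw [kernel_conj_symm hD hμ₁ hz hz]; exact kernel_self_ne_zero hD hμ₁ hz
  have e3 := sub_eq_zero.1 ((mul_eq_zero.1 e2).resolve_left hne)
  rw [kernel_disc h₁ h2 hz, kernel_disc h₁ h2 hz'] at e3
  have n1 := one_sub_mul_conj_ne_zero (w := 1 / 2) (ζ := z 0) (by norm_num) (le_of_lt hz)
  have n2 := one_sub_mul_conj_ne_zero (w := 1 / 2) (ζ := z' 0) (by norm_num) (le_of_lt hz')
  rw [div_eq_div_iff (mul_ne_zero hpi (pow_ne_zero _ n1)) (mul_ne_zero hpi (pow_ne_zero _ n2)),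
    one_mul, one_mul] at e3
  have e4 := mul_left_cancel₀ hpi e3
  have e5 : (conj (z' 0) - conj (z 0)) * (1 - (1 / 4) * (conj (z 0) + conj (z' 0))) = 0 := by
    linear_combination (-1 : ℂ) * e4
  have n3 : 1 - (1 / 4) * (conj (z 0) + conj (z' 0)) ≠ 0 := fun h => by
    have h3 : ‖(1 / 4 : ℂ) * (conj (z 0) + conj (z' 0))‖ = 1 := by
      rw [← sub_eq_zero.1 h, norm_one]
    have h4 := norm_add_le (conj (z 0)) (conj (z' 0))
    have hz1 : ‖z 0‖ < 1 := hz
    have hz2 : ‖z' 0‖ < 1 := hz'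
    rw [RCLike.norm_conj, RCLike.norm_conj] at h4
    rw [norm_mul] at h3
    norm_num at h3
    linarith
  have e6 := (starRingEnd ℂ).injective (sub_eq_zero.1 ((mul_eq_zero.1 e5).resolve_right n3))
  funext i
  rw [Subsingleton.elim i 0, e6]

/-- A boundary cluster value of `f` in the disc would be a common zero of the functions
`K₂(·, f p)`. -/
theorem kernel_eq_zero_of_boundary_limit (h₁ : ∀ z ∈ closure disc, μ₁ z = 1)
    (hμ₂ : IsPositiveContinuousWeight disc μ₂) (hf : IsHolomorphicIsometry disc μ₁ disc μ₂ f)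
    {x : ℕ → Fin 1 → ℂ} (hx : ∀ k, x k ∈ disc) {ζ q : Fin 1 → ℂ} (hζ : Tendsto x atTop (𝓝 ζ))
    (hζ1 : ‖ζ 0‖ = 1) (hq : q ∈ disc) (hfx : Tendsto (fun k => f (x k)) atTop (𝓝 q))
    {p : Fin 1 → ℂ} (hp : p ∈ disc) : kernel disc μ₂ q (f p) = 0 := by
  have hD := isBoundedDomain_disc
  have hμ₁ := isPositiveContinuousWeight_of_eq_one h₁
  have hpi : (Real.pi : ℂ) ≠ 0 := by exact_mod_cast Real.pi_ne_zero
  have hfp := hf.mapsTo hp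
  have hx0 : Tendsto (fun k => x k 0) atTop (𝓝 (ζ 0)) :=
    (continuous_apply 0).continuousAt.tendsto.comp hζ
  have hxc : Tendsto (fun k => conj (x k 0)) atTop (𝓝 (conj (ζ 0))) :=
    (Complex.continuous_conj.tendsto _).comp hx0
  -- This is `1 / K₁(x k, x k)`. The kernel identity at `z = w = x k` is multiplied by it: one side
  -- tends to zero, the other to `K₁(p, p)` times the squared modulus of `K₂(q, f p)`.
  have hδ : Tendsto (fun k => Real.pi * (1 - x k 0 * conj (x k 0)) ^ 2) atTop (𝓝 0) := by
    have h : Tendsto (fun k => (Real.pi : ℂ) * (1 - x k 0 * conj (x k 0)) ^ 2) atTop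
        (𝓝 (Real.pi * (1 - ζ 0 * conj (ζ 0)) ^ 2)) :=
      (((hx0.mul hxc).const_sub 1).pow 2).const_mul _
    rwa [Complex.mul_conj, Complex.normSq_eq_norm_sq, hζ1, one_pow, Complex.ofReal_one, sub_self,
      zero_pow two_ne_zero, mul_zero] at h
  have hKpx : Tendsto (fun k => kernel disc μ₁ p (x k)) atTop
      (𝓝 (1 / (Real.pi * (1 - p 0 * conj (ζ 0)) ^ 2))) := by
    have h : Tendsto (fun k => 1 / ((Real.pi : ℂ) * (1 - p 0 * conj (x k 0)) ^ 2)) atTop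
        (𝓝 (1 / (Real.pi * (1 - p 0 * conj (ζ 0)) ^ 2))) :=
      tendsto_const_nhds.div ((((hxc.const_mul _).const_sub 1).pow 2).const_mul _)
        (mul_ne_zero hpi (pow_ne_zero _ (one_sub_mul_conj_ne_zero hp hζ1.le)))
    exact h.congr fun k => (kernel_disc h₁ hp (hx k)).symm
  have hKxp : Tendsto (fun k => kernel disc μ₁ (x k) p) atTop
      (𝓝 (conj (1 / (Real.pi * (1 - p 0 * conj (ζ 0)) ^ 2)))) :=
    ((Complex.continuous_conj.tendsto _).comp hKpx).congr fun k =>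
      kernel_conj_symm hD hμ₁ hp (hx k)
  have hfq : Tendsto (fun k => f (x k)) atTop (𝓝[disc] q) :=
    tendsto_nhdsWithin_iff.2 ⟨hfx, Eventually.of_forall fun k => hf.mapsTo (hx k)⟩
  have hK2 : Tendsto (fun k => kernel disc μ₂ (f (x k)) (f (x k))) atTop (𝓝 (kernel disc μ₂ q q)) :=
    (continuousOn_kernel_self hD hμ₂ q hq).tendsto.comp hfq
  have hK2p : Tendsto (fun k => kernel disc μ₂ (f (x k)) (f p)) atTop
      (𝓝 (kernel disc μ₂ q (f p))) :=
    ((kernel_mem_bergmanSpace hD hμ₂ hfp).1.continuousOn q hq).tendsto.comp hfq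
  have hK2p' : Tendsto (fun k => kernel disc μ₂ (f p) (f (x k))) atTop
      (𝓝 (conj (kernel disc μ₂ q (f p)))) :=
    ((Complex.continuous_conj.tendsto _).comp hK2p).congr fun k =>
      kernel_conj_symm hD hμ₂ (hf.mapsTo (hx k)) hfp
  have hL := ((((hK2.mul hKxp).mul hKpx).mul_const (kernel disc μ₂ (f p) (f p))).mul hδ)
  have hR := (hK2p.mul hK2p').mul_const (kernel disc μ₁ p p)
  rw [mul_zero] at hL
  have heq := tendsto_nhds_unique (hR.congr fun k => ?_) hL
  · have h1 := (mul_eq_zero.1 heq).resolve_right (kernel_self_ne_zero hD hμ₁ hp)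
    rw [Complex.mul_conj] at h1
    exact Complex.normSq_eq_zero.1 (Complex.ofReal_eq_zero.1 h1)
  · have hne : 1 - x k 0 * conj (x k 0) ≠ 0 := one_sub_mul_conj_ne_zero (hx k) (le_of_lt (hx k))
    rw [hf.kernel_identity hD hD hμ₁ hμ₂ hp (hx k) (hx k), kernel_disc h₁ (hx k) (hx k)]
    field_simp

theorem isAutomorphism_of_isometry_disc (h₁ : ∀ z ∈ closure disc, μ₁ z = 1)
    (hμ₂ : IsPositiveContinuousWeight disc μ₂) (hf : IsHolomorphicIsometry disc μ₁ disc μ₂ f) :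
    IsAutomorphism disc f := by
  have hD := isBoundedDomain_disc
  have hinj := injOn_of_isometry_disc h₁ hμ₂ hf
  set e := ContinuousLinearEquiv.funUnique (Fin 1) ℂ ℂ
  have hde : disc = e ⁻¹' ball 0 1 := disc_eq_preimage
  have hsymm : MapsTo e.symm (ball 0 1) disc := fun t ht => by
    rw [hde, mem_preimage, e.apply_symm_apply]; exact ht
  set F : ℂ → ℂ := fun t => e (f (e.symm t))
  have hFd : DifferentiableOn ℂ F (ball 0 1) :=
    e.differentiable.comp_differentiableOn
      (hf.holomorphic.comp e.symm.differentiable.differentiableOn hsymm)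
  have hFi : InjOn F (ball 0 1) := fun s hs t ht hst =>
    e.symm.injective (hinj (hsymm hs) (hsymm ht) (e.injective hst))
  obtain ⟨hopen, hGd⟩ := differentiableOn_invFunOn isOpen_ball hFd hFi
  have himage : f '' disc = e ⁻¹' (F '' ball 0 1) := by
    ext y
    constructor
    · rintro ⟨z, hz, rfl⟩
      exact ⟨e z, by rwa [hde] at hz, by simp [F]⟩
    · rintro ⟨t, ht, hty⟩
      exact ⟨e.symm t, hsymm ht, e.injective hty⟩
  have hopen' : IsOpen (f '' disc) := by rw [himage]; exact hopen.preimage e.continuous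
  have h0 : (0 : Fin 1 → ℂ) ∈ disc := by simp [disc]
  -- The image is open and meets the connected disc, so it suffices that it contains its limit
  -- points `q` in the disc. Preimages of points tending to `q` accumulate at some `ζ` of the closed
  -- disc, and `‖ζ 0‖ = 1` has to be excluded.
  have hsurj : disc ⊆ f '' disc := by
    refine hD.isConnected.isPreconnected.subset_of_closure_inter_subset hopen'
      ⟨f 0, hf.mapsTo h0, mem_image_of_mem f h0⟩ ?_
    rintro q ⟨hqc, hq⟩
    obtain ⟨y, hy, hyq⟩ := mem_closure_iff_seq_limit.1 hqc
    choose z hz hzy using hy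
    obtain ⟨ζ, hζ, φ, hφ, hlim⟩ := hD.isBounded.isCompact_closure.tendsto_subseq
      fun k => subset_closure (hz k)
    have hfx : Tendsto (fun k => f (z (φ k))) atTop (𝓝 q) := by
      simp only [hzy]; exact hyq.comp hφ.tendsto_atTop
    have hle : ‖ζ 0‖ ≤ 1 := by
      have hcl : IsClosed {z : Fin 1 → ℂ | ‖z 0‖ ≤ 1} :=
        isClosed_le (by fun_prop) continuous_const
      exact closure_minimal (fun z hz => le_of_lt (show ‖z 0‖ < 1 from hz)) hcl hζ
    rcases hle.lt_or_eq with hlt | heq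
    · exact ⟨ζ, hlt, tendsto_nhds_unique
        ((hf.holomorphic.continuousOn.continuousAt (hD.isOpen.mem_nhds hlt)).tendsto.comp hlim) hfx⟩
    · exfalso
      have hzero : ∀ p ∈ disc, kernel disc μ₂ (f p) q = 0 := fun p hp => by
        rw [← kernel_conj_symm hD hμ₂ hq (hf.mapsTo hp), kernel_eq_zero_of_boundary_limit h₁ hμ₂ hf
          (fun k => hz (φ k)) hlim heq hq hfx hp, map_zero]
      refine kernel_self_ne_zero hD hμ₂ hq (eqOn_zero_of_eventuallyEq_zero hD.isOpen
        hD.isConnected.isPreconnected (kernel_mem_bergmanSpace hD hμ₂ hq).1 (hf.mapsTo h0)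
        (Filter.mem_of_superset (hopen'.mem_nhds (mem_image_of_mem f h0)) ?_) hq)
      rintro _ ⟨p, hp, rfl⟩
      exact hzero p hp
  have hFsurj : ball 0 1 ⊆ F '' ball 0 1 := fun t ht => by
    have := hsurj (hsymm ht)
    rw [himage] at this
    simpa using this
  set G := Function.invFunOn F (ball 0 1)
  have hG : MapsTo G (ball 0 1) (ball 0 1) := fun t ht => Function.invFunOn_mem (hFsurj ht)
  have hediff : MapsTo e disc (ball 0 1) := fun z hz => by rwa [hde] at hz
  refine ⟨hf.mapsTo, hf.holomorphic, fun z => e.symm (G (e z)), fun z hz => hsymm (hG (hediff hz)),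
    ?_, fun z hz => ?_, fun z hz => ?_⟩
  · exact e.symm.differentiable.comp_differentiableOn
      ((hGd.mono hFsurj).comp e.differentiable.differentiableOn hediff)
  · have h1 : G (F (e z)) = e z := hFi.leftInvOn_invFunOn (hediff hz)
    simp only [F, e.symm_apply_apply] at h1
    change e.symm (G (e (f z))) = z
    rw [h1, e.symm_apply_apply]
  · have h1 : F (G (e z)) = e z := Function.invFunOn_eq (hFsurj (hediff hz))
    exact e.injective h1

end DiscIsometry

end WeightedBergman
end

theorem theorem1p3 :
    (∀ (n m : ℕ) (D₁ : Set (Fin n → ℂ)) (D₂ : Set (Fin m → ℂ))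
        (μ₁ : (Fin n → ℂ) → ℝ) (μ₂ : (Fin m → ℂ) → ℝ) (f : (Fin n → ℂ) → (Fin m → ℂ)),
        WeightedBergman.IsBoundedDomain D₁ → WeightedBergman.IsBoundedDomain D₂ →
        WeightedBergman.IsPositiveContinuousWeight D₁ μ₁ →
        WeightedBergman.IsPositiveContinuousWeight D₂ μ₂ →
        WeightedBergman.IsHolomorphicIsometry D₁ μ₁ D₂ μ₂ f →
        ∃ s₀ ∈ WeightedBergman.bergmanSpace D₁ μ₁, ∃ r₀ ∈ WeightedBergman.bergmanSpace D₂ μ₂,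
          (∃ z ∈ D₁, s₀ z ≠ 0) ∧ (∃ z ∈ D₁, r₀ (f z) ≠ 0) ∧
          ∀ z ∈ D₁, ∀ w ∈ D₁,
            s₀ z * conj (s₀ w) * WeightedBergman.kernel D₂ μ₂ (f z) (f w) =
              r₀ (f z) * conj (r₀ (f w)) * WeightedBergman.kernel D₁ μ₁ z w) ∧
    (∀ (μ₁ μ₂ : (Fin 1 → ℂ) → ℝ) (f : (Fin 1 → ℂ) → (Fin 1 → ℂ)),
        (∀ z ∈ closure WeightedBergman.disc, μ₁ z = 1) →
        WeightedBergman.IsPositiveContinuousWeight WeightedBergman.disc μ₂ →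
        WeightedBergman.IsHolomorphicIsometry WeightedBergman.disc μ₁ WeightedBergman.disc μ₂ f →
        WeightedBergman.IsAutomorphism WeightedBergman.disc f) := by
  exact ⟨fun _ _ _ _ _ _ _ hD₁ hD₂ hμ₁ hμ₂ hf => hf.exists_kernel_factors hD₁ hD₂ hμ₁ hμ₂,
    fun _ _ _ h₁ hμ₂ hf => WeightedBergman.isAutomorphism_of_isometry_disc h₁ hμ₂ hf⟩
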